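/- A \emph{regular network} is an embedded planar network of finitely many $C^2$ curves (compact edges, and unbounded properly embedded half-open curves, called rays, each of which starts at a junction), which meet only at their end points, such that at every junction exactly three ends of curves meet and they form angles $\frac{2\pi}{3}$ with each other (the Herring condition). A \emph{regular shrinker} is an open regular network that satisfies $\bar k+x^\perp=0$ at every point, where $\bar k$ is the curvature vector and $x^\perp$ is the normal component of the position vector. The \emph{Cisgeminate 3-ray star} is the network shape with 10 junctions, 12 edges and 6 rays in which a central junction is joined by three edges (spokes) to three junctions $v_0,v_1,v_2$, and for each $i\in\mathbb Z/3$ the junctions $v_i$ and $v_{i+1}$ are joined by a path of three edges $v_i a_i$, $a_i b_i$, $b_i v_{i+1}$, with one ray starting at each $a_i$ and one at each $b_i$. It has three closed regions, each of which is a 5-cell with two rays attached. It is symmetric when it is invariant under the rotation by $\frac{2\pi}{3}$ about the origin. \textbf{Corollary.} There is no regular shrinker with the shape of the symmetric Cisgeminate 3-ray star. -/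

import Mathlib

open Set Filter

/-- A combinatorial graph with rays: every edge joins two vertices, and every ray is an unbounded
half-open curve issuing from one vertex. -/
structure RayGraph (V E R : Type) where
  /-- initial vertex of an edge -/
  src : E → V
  /-- terminal vertex of an edge -/
  tgt : E → V
  /-- the vertex at which a ray starts -/
  base : R → V

namespace RayGraph

variable {V E R : Type}

/-- The ends of curves at the vertices: `inl c` is the initial end of the curve `c`
(an edge or a ray), `inr e` is the terminal end of the edge `e`. -/
abbrev End (_G : RayGraph V E R) : Type := (E ⊕ R) ⊕ E

/-- The vertex at which an end of a curve sits. -/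
def endVertex (G : RayGraph V E R) : G.End → V :=
  Sum.elim (Sum.elim G.src G.base) G.tgt

end RayGraph

/-- Domains of the arc-length parametrizations: `[0, L]` for an edge of length `L`,
`[0, ∞)` for a ray. -/
def curveDomain {E R : Type} (length : E → ℝ) : E ⊕ R → Set ℝ :=
  Sum.elim (fun e => Icc 0 (length e)) (fun _ => Ici 0)

/-- An open embedded network of `C²` curves in the plane `ℂ = ℝ²` with underlying graph `G`.
The curves are parametrized by arc length, meet only at the vertices (multi-points),
and the rays are proper, i.e. they leave every compact set. -/
structure Network {V E R : Type} (G : RayGraph V E R) where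
  /-- position of a vertex in the plane -/
  pos : V → ℂ
  /-- length of an edge -/
  length : E → ℝ
  /-- arc-length parametrizations of the edges and of the rays -/
  curve : E ⊕ R → ℝ → ℂ
  length_pos : ∀ e, 0 < length e
  contDiffOn : ∀ c, ContDiffOn ℝ 2 (curve c) (curveDomain length c)
  unit_speed : ∀ c, ∀ s ∈ curveDomain length c,
    ‖derivWithin (curve c) (curveDomain length c) s‖ = 1
  edge_src : ∀ e, curve (Sum.inl e) 0 = pos (G.src e)
  edge_tgt : ∀ e, curve (Sum.inl e) (length e) = pos (G.tgt e)
  ray_base : ∀ r, curve (Sum.inr r) 0 = pos (G.base r)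
  ray_proper : ∀ r, Tendsto (curve (Sum.inr r)) atTop (cocompact ℂ)
  pos_injective : Function.Injective pos
  /-- An interior point of a curve lies on no other curve, and the curve passes it only once. -/
  embedded : ∀ c c' s s', s ∈ interior (curveDomain length c) → s' ∈ curveDomain length c' →
    curve c s = curve c' s' → c = c' ∧ s = s'

namespace Network

variable {V E R : Type} {G : RayGraph V E R}

/-- The parameter interval of a curve of the network. -/
def dom (N : Network G) (c : E ⊕ R) : Set ℝ := curveDomain N.length c

/-- The network as a subset of the plane. -/
def support (N : Network G) : Set ℂ := ⋃ c, N.curve c '' N.dom c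

/-- The unit tangent vector `T` of the curve `c` at the parameter `s`. -/
noncomputable def tangent (N : Network G) (c : E ⊕ R) (s : ℝ) : ℂ :=
  derivWithin (N.curve c) (N.dom c) s

/-- The curvature vector: the derivative of the unit tangent vector in arc length. -/
noncomputable def curvatureVector (N : Network G) (c : E ⊕ R) (s : ℝ) : ℂ :=
  derivWithin (N.tangent c) (N.dom c) s

/-- The normal component `x - ⟨T, x⟩ T` of the position vector `x` of the curve. -/
noncomputable def normalPosition (N : Network G) (c : E ⊕ R) (s : ℝ) : ℂ :=
  N.curve c s - inner ℝ (N.tangent c s) (N.curve c s) • N.tangent c s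

/-- The unit tangent vector at an end of a curve, pointing from the vertex into the curve. -/
noncomputable def endTangent (N : Network G) : G.End → ℂ :=
  Sum.elim (fun c => N.tangent c 0) (fun e => -N.tangent (Sum.inl e) (N.length e))

/-- The Herring condition: exactly three ends of curves meet at every vertex, and they form
angles of `2π/3` with each other. -/
def IsRegular (N : Network G) : Prop :=
  (∀ v, Nat.card {d : G.End // G.endVertex d = v} = 3) ∧
  ∀ d d' : G.End, d ≠ d' → G.endVertex d = G.endVertex d' →
    InnerProductGeometry.angle (N.endTangent d) (N.endTangent d') = 2 * Real.pi / 3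

/-- A regular shrinker: a regular open network with `k + x^⊥ = 0` at every point, where `k` is
the curvature vector and `x^⊥` the normal component of the position vector. -/
def IsRegularShrinker (N : Network G) : Prop :=
  N.IsRegular ∧ ∀ c, ∀ s ∈ N.dom c, N.curvatureVector c s + N.normalPosition c s = 0

/-- Invariance under the rotation by `2π/3` about the origin. -/
def HasThreefoldSymmetry (N : Network G) : Prop :=
  (fun z : ℂ => Complex.exp (2 * Real.pi / 3 * Complex.I) * z) '' N.support = N.support

end Network

/-- The junctions of the Cisgeminate 3-ray star: the centre, the outer ends of the three spokes,
and two junctions carrying rays between any two consecutive spokes. -/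
inductive StarVertex : Type
  | center : StarVertex
  | spokeEnd (i : ZMod 3) : StarVertex
  | firstTwin (i : ZMod 3) : StarVertex
  | secondTwin (i : ZMod 3) : StarVertex

/-- The edges of the Cisgeminate 3-ray star: three spokes, and three outer edges between the ends
of any two consecutive spokes. -/
inductive StarEdge : Type
  | spoke (i : ZMod 3) : StarEdge
  | outer₁ (i : ZMod 3) : StarEdge
  | outer₂ (i : ZMod 3) : StarEdge
  | outer₃ (i : ZMod 3) : StarEdge

/-- The six rays of the Cisgeminate 3-ray star. -/
inductive StarRay : Type
  | first (i : ZMod 3) : StarRay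
  | second (i : ZMod 3) : StarRay

/-- The graph of the Cisgeminate 3-ray star. Its three closed regions are the 5-cells bounded
by `spoke i`, `outer₁ i`, `outer₂ i`, `outer₃ i` and `spoke (i + 1)`; each of them has two rays
attached on the outside. -/
def cisgeminateThreeRayStar : RayGraph StarVertex StarEdge StarRay where
  src
    | .spoke _ => .center
    | .outer₁ i => .spokeEnd i
    | .outer₂ i => .firstTwin i
    | .outer₃ i => .secondTwin i
  tgt
    | .spoke i => .spokeEnd i
    | .outer₁ i => .firstTwin i
    | .outer₂ i => .secondTwin i
    | .outer₃ i => .spokeEnd (i + 1)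
  base
    | .first i => .firstTwin i
    | .second i => .secondTwin i

/-! The rotation permutes the junctions, and 10 is not a multiple of 3, so some junction lies at the
origin (`exists_pos_eq_zero`). On a shrinking curve `crossProd γ T * exp (-‖γ‖² / 2)` is constant: a
curve that is radial at one point is straight and radial throughout, and on a ray properness forces
the constant to be 0. Away from the origin two radial ends cannot meet at the Herring angle; this
excludes every junction but the centre from the origin. So the spokes are segments issuing from the
origin at mutual angles 2π/3, the rays point radially outwards, and the outer edges meet the radial
direction at prescribed angles.

On an outer edge let c be the cosine of the angle between position and tangent, θ the polar angle, E
the conserved energy and m² = 1 - E. Then |c| ≤ m, and the phase arcsin (c / m) advances at most √2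
times as fast as θ (`arcsin_sub_le`). Along an outer path the end values of c are 1/2, 1/2, then
-1/2, 1/2, then -1/2, -1/2, and E is the same on all three edges. Depending on whether the twins lie
inside the unit circle, one finds disjoint stretches whose phase advances sum to at least π. As θ
increases everywhere, the path turns by at least π/√2 > 2π/3 (`two_pi_div_three_lt_angle`).

All three paths turn in the same sense, each by more than the angle between consecutive spokes. The
path that turns least therefore overlaps in angle with the one starting at the next spoke, and since
neither may cross a spoke, the two paths must cross each other (`false_of_hasPolarGraph`). -/

/-! ### The radial equations of a shrinking curve and the phase estimate -/

/-- The equations of motion of a shrinking curve of length `L` in terms of the tangential component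
`d` and the normal component `w` of the position vector and of the polar angle `θ`. -/
structure ShrinkerODE (L : ℝ) (d w θ : ℝ → ℝ) : Prop where
  length_pos : 0 < L
  hasDeriv_d : ∀ s ∈ Icc 0 L, HasDerivWithinAt d (1 - w s ^ 2) (Icc 0 L) s
  hasDeriv_w : ∀ s ∈ Icc 0 L, HasDerivWithinAt w (w s * d s) (Icc 0 L) s
  hasDeriv_θ : ∀ s ∈ Icc 0 L, HasDerivWithinAt θ (w s / (d s ^ 2 + w s ^ 2)) (Icc 0 L) s
  w_pos : ∀ s ∈ Icc 0 L, 0 < w s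

/-- The energy `w² exp (1 - r²)`, where `r² = d² + w²`. -/
noncomputable def energy (d w : ℝ → ℝ) (s : ℝ) : ℝ := w s ^ 2 * Real.exp (1 - (d s ^ 2 + w s ^ 2))

/-- The cosine of the angle between the position vector and the tangent vector. -/
noncomputable def radialCos (d w : ℝ → ℝ) (s : ℝ) : ℝ := d s / √(d s ^ 2 + w s ^ 2)

/-- With z = 1 - y the difference of the two sides is 2 - 2(1 - z)eᶻ - z², which vanishes at z = 0
and has derivative 2z(eᶻ - 1) ≥ 0. This is the source of the constant √2 in the phase estimate. -/
theorem sq_le_two_mul_one_sub {y : ℝ} (hy : y ≤ 1) :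
    (1 - y) ^ 2 ≤ 2 * (1 - y * Real.exp (1 - y)) := by
  have h : MonotoneOn (fun z : ℝ => 2 - 2 * ((1 - z) * Real.exp z) - z ^ 2) (Ici 0) := by
    apply monotoneOn_of_deriv_nonneg (convex_Ici 0)
    · fun_prop
    · fun_prop
    · intro z hz
      rw [interior_Ici, mem_Ioi] at hz
      have : HasDerivAt (fun z : ℝ => 2 - 2 * ((1 - z) * Real.exp z) - z ^ 2)
          (2 * z * (Real.exp z - 1)) z := by
        have h1 := (((hasDerivAt_id z).const_sub 1).mul (Real.hasDerivAt_exp z)).const_mul 2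
        have h2 := (h1.const_sub 2).sub ((hasDerivAt_id z).pow 2)
        exact h2.congr_deriv (by simp; ring)
      rw [this.deriv]
      have := Real.add_one_le_exp z
      exact mul_nonneg (by positivity) (by linarith)
  have := h (a := 0) (b := 1 - y) (by simp) (by simpa using hy) (by linarith)
  simp only [sub_zero, Real.exp_zero] at this
  ring_nf at this ⊢
  linarith

theorem mul_exp_one_sub_le_one (y : ℝ) : y * Real.exp (1 - y) ≤ 1 := by
  have h := Real.add_one_le_exp (y - 1)
  have h2 : Real.exp (y - 1) * Real.exp (1 - y) = 1 := by
    rw [← Real.exp_add]; simp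
  nlinarith [Real.exp_pos (1 - y)]

theorem strictMonoOn_mul_exp_one_sub :
    StrictMonoOn (fun y : ℝ => y * Real.exp (1 - y)) (Iic 1) := by
  apply strictMonoOn_of_deriv_pos (convex_Iic 1)
  · fun_prop
  · intro z hz
    rw [interior_Iic, mem_Iio] at hz
    have : HasDerivAt (fun y : ℝ => y * Real.exp (1 - y)) ((1 - z) * Real.exp (1 - z)) z := by
      have h1 := (hasDerivAt_id z).mul ((hasDerivAt_id z).const_sub 1).exp
      exact h1.congr_deriv (by simp; ring)
    rw [this.deriv]
    exact mul_pos (by linarith) (Real.exp_pos _)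

namespace ShrinkerODE

variable {L : ℝ} {d w θ : ℝ → ℝ}

theorem radius_pos (h : ShrinkerODE L d w θ) {s : ℝ} (hs : s ∈ Icc 0 L) :
    0 < d s ^ 2 + w s ^ 2 := by
  have := h.w_pos s hs
  positivity

theorem hasDeriv_radius (h : ShrinkerODE L d w θ) {s : ℝ} (hs : s ∈ Icc 0 L) :
    HasDerivWithinAt (fun s => d s ^ 2 + w s ^ 2) (2 * d s) (Icc 0 L) s := by
  exact (((h.hasDeriv_d s hs).pow 2).add ((h.hasDeriv_w s hs).pow 2)).congr_deriv (by simp; ring)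

theorem hasDeriv_radialCos (h : ShrinkerODE L d w θ) {s : ℝ} (hs : s ∈ Icc 0 L) :
    HasDerivWithinAt (radialCos d w)
      (w s ^ 2 * (1 - (d s ^ 2 + w s ^ 2)) / ((d s ^ 2 + w s ^ 2) * √(d s ^ 2 + w s ^ 2)))
      (Icc 0 L) s := by
  have hy := h.radius_pos hs
  have hq := Real.sqrt_pos.2 hy
  have hqq := Real.sq_sqrt hy.le
  refine ((h.hasDeriv_d s hs).div ((h.hasDeriv_radius hs).sqrt hy.ne') hq.ne').congr_deriv ?_
  set q := √(d s ^ 2 + w s ^ 2)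
  rw [← hqq]
  field_simp
  linear_combination hqq

theorem energy_eq (h : ShrinkerODE L d w θ) {s : ℝ} (hs : s ∈ Icc 0 L) :
    energy d w s = energy d w 0 := by
  have hE : ∀ s ∈ Icc 0 L, HasDerivWithinAt (energy d w) 0 (Icc 0 L) s := by
    intro s hs
    exact (((h.hasDeriv_w s hs).pow 2).mul
      (((h.hasDeriv_radius hs).const_sub 1).exp)).congr_deriv (by simp; ring)
  apply constant_of_derivWithin_zero (fun s hs => (hE s hs).differentiableWithinAt)
    (fun s hs => ?_) s hs
  exact (hE s (Ico_subset_Icc_self hs)).derivWithin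
    (uniqueDiffOn_Icc h.length_pos s (Ico_subset_Icc_self hs))

/-- Measures how far the cosine is from its extreme values ±m. The right side is nonnegative, and it
vanishes exactly at radius 1. -/
theorem one_sub_energy_sub_sq (h : ShrinkerODE L d w θ) {s : ℝ} (hs : s ∈ Icc 0 L) :
    1 - energy d w 0 - radialCos d w s ^ 2 = w s ^ 2 / (d s ^ 2 + w s ^ 2) *
      (1 - (d s ^ 2 + w s ^ 2) * Real.exp (1 - (d s ^ 2 + w s ^ 2))) := by
  have hy := h.radius_pos hs
  rw [← h.energy_eq hs, radialCos, energy, div_pow, Real.sq_sqrt hy.le]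
  field_simp
  ring

theorem sq_radialCos_le (h : ShrinkerODE L d w θ) {s : ℝ} (hs : s ∈ Icc 0 L) :
    radialCos d w s ^ 2 ≤ 1 - energy d w 0 := by
  have h1 := h.one_sub_energy_sub_sq hs
  have h2 := mul_exp_one_sub_le_one (d s ^ 2 + w s ^ 2)
  have hy := h.radius_pos hs
  have : 0 ≤ w s ^ 2 / (d s ^ 2 + w s ^ 2) *
      (1 - (d s ^ 2 + w s ^ 2) * Real.exp (1 - (d s ^ 2 + w s ^ 2))) :=
    mul_nonneg (by positivity) (by linarith)
  linarith

/-- After inserting `one_sub_energy_sub_sq` and cancelling the common factor, what remains is 1 - y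
≤ √(2(1 - y exp (1 - y))) with y = r². Inside the unit circle this is `sq_le_two_mul_one_sub`;
outside, the left side is negative. -/
theorem deriv_radialCos_le (h : ShrinkerODE L d w θ) {s : ℝ} (hs : s ∈ Icc 0 L) :
    w s ^ 2 * (1 - (d s ^ 2 + w s ^ 2)) / ((d s ^ 2 + w s ^ 2) * √(d s ^ 2 + w s ^ 2)) ≤
      √2 * (w s / (d s ^ 2 + w s ^ 2)) * √(1 - energy d w 0 - radialCos d w s ^ 2) := by
  have hy := h.radius_pos hs
  have hw := h.w_pos s hs
  rw [h.one_sub_energy_sub_sq hs]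
  set y := d s ^ 2 + w s ^ 2
  have hq := Real.sqrt_pos.2 hy
  have e1 : √(w s ^ 2 / y * (1 - y * Real.exp (1 - y))) =
      w s / √y * √(1 - y * Real.exp (1 - y)) := by
    rw [Real.sqrt_mul (by positivity), Real.sqrt_div (by positivity), Real.sqrt_sq hw.le]
  have e2 : w s ^ 2 * (1 - y) / (y * √y) = w s ^ 2 / (y * √y) * (1 - y) := by ring
  have e3 : √2 * (w s / y) * (w s / √y * √(1 - y * Real.exp (1 - y))) =
      w s ^ 2 / (y * √y) * √(2 * (1 - y * Real.exp (1 - y))) := by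
    rw [Real.sqrt_mul (by positivity)]
    field_simp
  rw [e1, e2, e3]
  refine mul_le_mul_of_nonneg_left ?_ (by positivity)
  rcases le_or_gt y 1 with h1 | h1
  · exact Real.le_sqrt_of_sq_le (sq_le_two_mul_one_sub h1)
  · exact le_trans (by linarith) (Real.sqrt_nonneg _)

theorem continuousOn_radialCos (h : ShrinkerODE L d w θ) :
    ContinuousOn (radialCos d w) (Icc 0 L) :=
  fun _ hs => (h.hasDeriv_radialCos hs).continuousWithinAt

theorem continuousOn_radius (h : ShrinkerODE L d w θ) :
    ContinuousOn (fun s => d s ^ 2 + w s ^ 2) (Icc 0 L) :=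
  fun _ hs => (h.hasDeriv_radius hs).continuousWithinAt

theorem continuousOn_θ (h : ShrinkerODE L d w θ) : ContinuousOn θ (Icc 0 L) :=
  fun s hs => (h.hasDeriv_θ s hs).continuousWithinAt

theorem strictMonoOn_θ (h : ShrinkerODE L d w θ) : StrictMonoOn θ (Icc 0 L) := by
  apply strictMonoOn_of_deriv_pos (convex_Icc 0 L) h.continuousOn_θ
  intro s hs
  have hs' := interior_subset hs
  rw [((h.hasDeriv_θ s hs').hasDerivAt (mem_interior_iff_mem_nhds.1 hs)).deriv]
  exact div_pos (h.w_pos s hs') (h.radius_pos hs')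

/-- Choosing m² strictly above 1 - E keeps the argument of arcsin away from ±1, where arcsin is not
differentiable. The sharp value of m is reached by a limit in `arcsin_sub_le`. -/
theorem arcsin_sub_le_of_lt (h : ShrinkerODE L d w θ) {m : ℝ} (hm0 : 0 < m)
    (hm : 1 - energy d w 0 < m ^ 2) {s t : ℝ} (hs : s ∈ Icc 0 L) (ht : t ∈ Icc 0 L) (hst : s ≤ t) :
    Real.arcsin (radialCos d w t / m) - Real.arcsin (radialCos d w s / m) ≤
      √2 * (θ t - θ s) := by
  have hlt : ∀ s ∈ Icc 0 L, (radialCos d w s / m) ^ 2 < 1 := by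
    intro s hs
    rw [div_pow, div_lt_one (by positivity)]
    exact (h.sq_radialCos_le hs).trans_lt hm
  have hD : ∀ s ∈ Icc 0 L, HasDerivWithinAt
      (fun s => √2 * θ s - Real.arcsin (radialCos d w s / m))
      (√2 * (w s / (d s ^ 2 + w s ^ 2)) - 1 / √(1 - (radialCos d w s / m) ^ 2) *
        (w s ^ 2 * (1 - (d s ^ 2 + w s ^ 2)) /
          ((d s ^ 2 + w s ^ 2) * √(d s ^ 2 + w s ^ 2)) / m)) (Icc 0 L) s := by
    intro s hs
    have hl := abs_lt.1 ((sq_lt_one_iff_abs_lt_one _).1 (hlt s hs))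
    exact ((h.hasDeriv_θ s hs).const_mul √2).sub
      ((Real.hasDerivAt_arcsin hl.1.ne' hl.2.ne).comp_hasDerivWithinAt (h₂ := Real.arcsin)
        (h := fun s => radialCos d w s / m) s
        ((h.hasDeriv_radialCos hs).div_const m))
  have hmono : MonotoneOn (fun s => √2 * θ s - Real.arcsin (radialCos d w s / m)) (Icc 0 L) := by
    apply monotoneOn_of_deriv_nonneg (convex_Icc 0 L)
      (fun s hs => (hD s hs).continuousWithinAt)
      (fun s hs => ((hD s (interior_subset hs)).mono interior_subset).differentiableWithinAt)
    intro s hs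
    have hs' := interior_subset hs
    rw [((hD s hs').hasDerivAt (mem_interior_iff_mem_nhds.1 hs)).deriv, sub_nonneg]
    have e : √(1 - (radialCos d w s / m) ^ 2) * m = √(m ^ 2 - radialCos d w s ^ 2) := by
      nth_rw 2 [← Real.sqrt_sq hm0.le]
      rw [← Real.sqrt_mul (by linarith [hlt s hs'])]
      congr 1
      field_simp
    have hp : 0 < √(m ^ 2 - radialCos d w s ^ 2) :=
      Real.sqrt_pos.2 (by linarith [h.sq_radialCos_le hs'])
    have hwy : 0 ≤ √2 * (w s / (d s ^ 2 + w s ^ 2)) :=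
      mul_nonneg (Real.sqrt_nonneg _) (div_pos (h.w_pos s hs') (h.radius_pos hs')).le
    rw [div_mul_div_comm, one_mul, e, div_le_iff₀ hp]
    refine (h.deriv_radialCos_le hs').trans (mul_le_mul_of_nonneg_left ?_ hwy)
    exact Real.sqrt_le_sqrt (by linarith)
  have := hmono hs ht hst
  simp only at this
  linarith

/-- The phase `arcsin (radialCos / m)`, `m² = 1 - energy`, advances at most `√2` times as fast as
the polar angle. -/
theorem arcsin_sub_le (h : ShrinkerODE L d w θ) {m : ℝ} (hm0 : 0 < m)
    (hm : m ^ 2 = 1 - energy d w 0) {s t : ℝ} (hs : s ∈ Icc 0 L) (ht : t ∈ Icc 0 L) (hst : s ≤ t) :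
    Real.arcsin (radialCos d w t / m) - Real.arcsin (radialCos d w s / m) ≤
      √2 * (θ t - θ s) := by
  have hc : ContinuousAt (fun m => Real.arcsin (radialCos d w t / m) -
      Real.arcsin (radialCos d w s / m)) m := by
    have := Real.continuous_arcsin
    exact (this.continuousAt.comp (f := fun m => radialCos d w t / m)
        (continuousAt_const.div continuousAt_id hm0.ne')).sub
      (this.continuousAt.comp (f := fun m => radialCos d w s / m)
        (continuousAt_const.div continuousAt_id hm0.ne'))
  refine le_of_tendsto (hc.tendsto.mono_left (nhdsWithin_le_nhds (s := Ioi m))) ?_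
  filter_upwards [self_mem_nhdsWithin] with m' hm'
  have hm' : m < m' := hm'
  exact h.arcsin_sub_le_of_lt (hm0.trans hm') (by nlinarith) hs ht hst

/-- At an interior critical point the cosine attains an extreme value. -/
theorem sq_radialCos_eq_of_deriv_eq_zero (h : ShrinkerODE L d w θ) {s : ℝ} (hs : s ∈ Ioo 0 L)
    (h0 : deriv (radialCos d w) s = 0) : radialCos d w s ^ 2 = 1 - energy d w 0 := by
  have hs' := Ioo_subset_Icc_self hs
  rw [((h.hasDeriv_radialCos hs').hasDerivAt (Icc_mem_nhds hs.1 hs.2)).deriv] at h0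
  have hy := h.radius_pos hs'
  have hw := h.w_pos s hs'
  have hq := Real.sqrt_pos.2 hy
  have h1 := h.one_sub_energy_sub_sq hs'
  rw [div_eq_zero_iff] at h0
  have h2 : d s ^ 2 + w s ^ 2 = 1 := by
    rcases h0 with h0 | h0
    · rcases mul_eq_zero.1 h0 with h0 | h0
      · exact absurd h0 (by positivity)
      · linarith
    · exact absurd h0 (by positivity)
  rw [h2] at h1
  simp at h1
  linarith

/-- Reversal of the parametrization. -/
theorem reverse (h : ShrinkerODE L d w θ) :
    ShrinkerODE L (fun s => -d (L - s)) (fun s => w (L - s)) (fun s => -θ (L - s)) := by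
  have hm : ∀ s ∈ Icc 0 L, L - s ∈ Icc 0 L := fun s hs => ⟨by linarith [hs.2], by linarith [hs.1]⟩
  have key : ∀ (f : ℝ → ℝ) (f' s : ℝ), s ∈ Icc 0 L → HasDerivWithinAt f f' (Icc 0 L) (L - s) →
      HasDerivWithinAt (fun s => f (L - s)) (-f') (Icc 0 L) s := by
    intro f f' s hs hf
    have := hf.comp s ((hasDerivWithinAt_id s (Icc 0 L)).const_sub L) hm
    exact this.congr_deriv (by simp)
  refine ⟨h.length_pos, fun s hs => ?_, fun s hs => ?_, fun s hs => ?_, fun s hs => h.w_pos _ (hm s hs)⟩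
  · exact (key _ _ s hs (h.hasDeriv_d _ (hm s hs))).neg.congr_deriv (by simp)
  · exact (key _ _ s hs (h.hasDeriv_w _ (hm s hs))).congr_deriv (by simp)
  · exact (key _ _ s hs (h.hasDeriv_θ _ (hm s hs))).neg.congr_deriv (by simp)

theorem radialCos_reverse (s : ℝ) :
    radialCos (fun s => -d (L - s)) (fun s => w (L - s)) s = -radialCos d w (L - s) := by
  simp [radialCos, neg_div]

theorem energy_reverse (h : ShrinkerODE L d w θ) :
    energy (fun s => -d (L - s)) (fun s => w (L - s)) 0 = energy d w 0 := by
  rw [← h.energy_eq (right_mem_Icc.2 h.length_pos.le)]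
  simp [energy]

/-- If the cosine does not attain its minimum at an end of the curve, it attains the least value
that the energy permits. -/
theorem exists_radialCos_eq_neg_of_lt (h : ShrinkerODE L d w θ) {m : ℝ} (hm0 : 0 < m)
    (hm : m ^ 2 = 1 - energy d w 0) {s₀ : ℝ} (hs₀ : s₀ ∈ Icc 0 L)
    (h0 : radialCos d w s₀ < radialCos d w 0) (hL : radialCos d w s₀ < radialCos d w L)
    (hle : radialCos d w s₀ ≤ 0) : ∃ s ∈ Icc 0 L, radialCos d w s = -m := by
  obtain ⟨s, hs, hmin⟩ := isCompact_Icc.exists_isMinOn (nonempty_Icc.2 h.length_pos.le)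
    h.continuousOn_radialCos
  have hss₀ : radialCos d w s ≤ radialCos d w s₀ := hmin hs₀
  -- The minimum is interior, hence a critical point, and there c = ±m; the sign follows because the
  -- minimum is at most 0.
  have hs' : s ∈ Ioo 0 L := by
    refine ⟨lt_of_le_of_ne hs.1 ?_, lt_of_le_of_ne hs.2 ?_⟩
    · rintro rfl; linarith
    · rintro rfl; linarith
  have h2 := h.sq_radialCos_eq_of_deriv_eq_zero hs'
    ((hmin.isLocalMin (Icc_mem_nhds hs'.1 hs'.2)).deriv_eq_zero)
  refine ⟨s, hs, ?_⟩
  rw [← hm, sq_eq_sq_iff_eq_or_eq_neg] at h2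
  rcases h2 with h2 | h2
  · linarith
  · exact h2

/-- Since (r²)' = 2d, a cosine that stays positive makes the radius strictly increase. So the cosine
must become nonpositive somewhere between its positive end values. -/
theorem exists_radialCos_eq_neg_of_radius_le (h : ShrinkerODE L d w θ) {m : ℝ} (hm0 : 0 < m)
    (hm : m ^ 2 = 1 - energy d w 0) (h0 : 0 < radialCos d w 0) (hL : 0 < radialCos d w L)
    (hle : d L ^ 2 + w L ^ 2 ≤ d 0 ^ 2 + w 0 ^ 2) : ∃ s ∈ Icc 0 L, radialCos d w s = -m := by
  by_cases hex : ∃ s ∈ Icc 0 L, radialCos d w s ≤ 0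
  · obtain ⟨s, hs, hs0⟩ := hex
    exact h.exists_radialCos_eq_neg_of_lt hm0 hm hs (by linarith) (by linarith) hs0
  · push Not at hex
    have : StrictMonoOn (fun s => d s ^ 2 + w s ^ 2) (Icc 0 L) := by
      apply strictMonoOn_of_deriv_pos (convex_Icc 0 L) h.continuousOn_radius
      intro s hs
      have hs' := interior_subset hs
      rw [((h.hasDeriv_radius hs').hasDerivAt (mem_interior_iff_mem_nhds.1 hs)).deriv]
      have hp := hex s hs'
      rw [radialCos, div_pos_iff_of_pos_right (Real.sqrt_pos.2 (h.radius_pos hs'))] at hp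
      linarith
    have := this (left_mem_Icc.2 h.length_pos.le) (right_mem_Icc.2 h.length_pos.le) h.length_pos
    simp only at this
    linarith

/-- Outside the unit circle the cosine decreases, so it first drops below its initial value and then
has an interior minimum. If the curve starts on the unit circle, the initial value already equals
-m. -/
theorem exists_radialCos_eq_neg_of_one_le (h : ShrinkerODE L d w θ) {m : ℝ} (hm0 : 0 < m)
    (hm : m ^ 2 = 1 - energy d w 0) (h0 : radialCos d w 0 < 0) (hL : 0 < radialCos d w L)
    (hle : 1 ≤ d 0 ^ 2 + w 0 ^ 2) : ∃ s ∈ Icc 0 L, radialCos d w s = -m := by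
  have hz := left_mem_Icc.2 h.length_pos.le
  rcases hle.eq_or_lt with h1 | h1
  · refine ⟨0, hz, ?_⟩
    have h2 := h.one_sub_energy_sub_sq hz
    rw [← h1] at h2
    simp only [sub_self, Real.exp_zero, mul_one, mul_zero] at h2
    have h3 : radialCos d w 0 ^ 2 = m ^ 2 := by linarith
    rw [sq_eq_sq_iff_eq_or_eq_neg] at h3
    rcases h3 with h3 | h3
    · linarith
    · exact h3
  · have hev : ∀ᶠ s in nhdsWithin 0 (Icc 0 L), 1 < d s ^ 2 + w s ^ 2 :=
      (h.continuousOn_radius 0 hz).eventually (lt_mem_nhds h1)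
    rw [eventually_iff, Metric.mem_nhdsWithin_iff] at hev
    obtain ⟨ε, hε, hb⟩ := hev
    set t := min (ε / 2) L with ht
    have ht0 : 0 < t := lt_min (by linarith) h.length_pos
    have hsub : Icc 0 t ⊆ Icc 0 L := Icc_subset_Icc_right (min_le_right _ _)
    have hlt : ∀ s ∈ Icc 0 t, 1 < d s ^ 2 + w s ^ 2 := by
      intro s hs
      refine hb ⟨?_, hsub hs⟩
      rw [Metric.mem_ball, Real.dist_eq, sub_zero, abs_of_nonneg hs.1]
      linarith [hs.2, min_le_left (ε / 2) L]
    have hanti : StrictAntiOn (radialCos d w) (Icc 0 t) := by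
      apply strictAntiOn_of_deriv_neg (convex_Icc 0 t) (h.continuousOn_radialCos.mono hsub)
      intro s hs
      rw [interior_Icc] at hs
      have hs1 := Ioo_subset_Icc_self hs
      have hs' := hsub hs1
      rw [((h.hasDeriv_radialCos hs').hasDerivAt
        (Icc_mem_nhds hs.1 (hs.2.trans_le (min_le_right _ _)))).deriv]
      have hw := h.w_pos s hs'
      have hy := h.radius_pos hs'
      have hq := Real.sqrt_pos.2 hy
      exact div_neg_of_neg_of_pos
        (mul_neg_of_pos_of_neg (by positivity) (by linarith [hlt s hs1])) (by positivity)
    have := hanti (left_mem_Icc.2 ht0.le) (right_mem_Icc.2 ht0.le) ht0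
    exact h.exists_radialCos_eq_neg_of_lt hm0 hm (hsub (right_mem_Icc.2 ht0.le)) this
      (by linarith) (by linarith)

end ShrinkerODE

theorem pi_div_six_le_arcsin {m : ℝ} (hm0 : 0 < m) (hm : m ≤ 1) :
    Real.pi / 6 ≤ Real.arcsin (1 / 2 / m) := by
  have h1 : Real.arcsin (1 / 2) = Real.pi / 6 := by
    rw [← Real.sin_pi_div_six]
    exact Real.arcsin_sin (by linarith [Real.pi_pos]) (by linarith [Real.pi_pos])
  rw [← h1]
  apply Real.monotone_arcsin
  rw [le_div_iff₀ hm0]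
  linarith

/-- A chain of three shrinking curves with the same energy, which form the Herring angles with the
radial direction at their four ends, turns around the origin by more than `2π/3`. -/
theorem two_pi_div_three_lt_angle {L₁ L₂ L₃ : ℝ} {d₁ w₁ θ₁ d₂ w₂ θ₂ d₃ w₃ θ₃ : ℝ → ℝ}
    (h₁ : ShrinkerODE L₁ d₁ w₁ θ₁) (h₂ : ShrinkerODE L₂ d₂ w₂ θ₂) (h₃ : ShrinkerODE L₃ d₃ w₃ θ₃)
    (hc₁ : radialCos d₁ w₁ 0 = 1 / 2) (hc₁' : radialCos d₁ w₁ L₁ = 1 / 2)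
    (hc₂ : radialCos d₂ w₂ 0 = -(1 / 2)) (hc₂' : radialCos d₂ w₂ L₂ = 1 / 2)
    (hc₃ : radialCos d₃ w₃ 0 = -(1 / 2)) (hc₃' : radialCos d₃ w₃ L₃ = -(1 / 2))
    (hy₁₂ : d₁ L₁ ^ 2 + w₁ L₁ ^ 2 = d₂ 0 ^ 2 + w₂ 0 ^ 2)
    (hy₂₃ : d₂ L₂ ^ 2 + w₂ L₂ ^ 2 = d₃ 0 ^ 2 + w₃ 0 ^ 2) :
    2 * Real.pi / 3 < (θ₁ L₁ - θ₁ 0) + (θ₂ L₂ - θ₂ 0) + (θ₃ L₃ - θ₃ 0) := by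
  -- the energy in terms of the distance at an end
  have hE : ∀ {L : ℝ} {d w θ : ℝ → ℝ} (h : ShrinkerODE L d w θ) {s : ℝ}, s ∈ Icc 0 L →
      radialCos d w s ^ 2 = 1 / 4 → energy d w 0 =
        3 / 4 * ((d s ^ 2 + w s ^ 2) * Real.exp (1 - (d s ^ 2 + w s ^ 2))) := by
    intro L d w θ h s hs hc
    have hy := h.radius_pos hs
    rw [← h.energy_eq hs, energy]
    rw [radialCos, div_pow, Real.sq_sqrt hy.le, div_eq_iff hy.ne'] at hc
    rw [← mul_assoc, ← show w s ^ 2 = 3 / 4 * (d s ^ 2 + w s ^ 2) by linarith]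
  have z₁ := left_mem_Icc.2 h₁.length_pos.le
  have z₂ := left_mem_Icc.2 h₂.length_pos.le
  have z₃ := left_mem_Icc.2 h₃.length_pos.le
  have l₁ := right_mem_Icc.2 h₁.length_pos.le
  have l₂ := right_mem_Icc.2 h₂.length_pos.le
  have l₃ := right_mem_Icc.2 h₃.length_pos.le
  have E₁ := hE h₁ z₁ (by rw [hc₁]; norm_num)
  have E₁' := hE h₁ l₁ (by rw [hc₁']; norm_num)
  have E₂ := hE h₂ z₂ (by rw [hc₂]; norm_num)
  have E₂' := hE h₂ l₂ (by rw [hc₂']; norm_num)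
  have E₃ := hE h₃ z₃ (by rw [hc₃]; norm_num)
  have E₃' := hE h₃ l₃ (by rw [hc₃']; norm_num)
  -- At a Herring end c² = 1/4, so the energy depends on the radius alone. Consecutive edges share a
  -- junction and hence the energy, and a single m serves all three edges.
  have E₁₂ : energy d₁ w₁ 0 = energy d₂ w₂ 0 := by rw [E₁', E₂, hy₁₂]
  have E₂₃ : energy d₂ w₂ 0 = energy d₃ w₃ 0 := by rw [E₂', E₃, hy₂₃]
  have hq : (1 / 2 : ℝ) ^ 2 ≤ 1 - energy d₂ w₂ 0 := by
    rw [← hc₂']; exact h₂.sq_radialCos_le l₂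
  set m := √(1 - energy d₂ w₂ 0) with hm
  have hm2 : m ^ 2 = 1 - energy d₂ w₂ 0 := Real.sq_sqrt (by linarith)
  have hm0 : 0 < m := Real.sqrt_pos.2 (by linarith)
  have hE0 : 0 ≤ energy d₂ w₂ 0 := by unfold energy; positivity
  have hm1 : m ≤ 1 := by nlinarith
  have hm₁ : m ^ 2 = 1 - energy d₁ w₁ 0 := by rw [hm2, E₁₂]
  have hm₃ : m ^ 2 = 1 - energy d₃ w₃ 0 := by rw [hm2, E₂₃]
  have hA := pi_div_six_le_arcsin hm0 hm1
  have hA' : Real.arcsin (-(1 / 2) / m) = -Real.arcsin (1 / 2 / m) := by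
    rw [neg_div, Real.arcsin_neg]
  have hmm : Real.arcsin (m / m) = Real.pi / 2 := by rw [div_self hm0.ne', Real.arcsin_one]
  have hmm' : Real.arcsin (-m / m) = -(Real.pi / 2) := by
    rw [neg_div, div_self hm0.ne', Real.arcsin_neg_one]
  have i₁ : 0 < θ₁ L₁ - θ₁ 0 := sub_pos.2 (h₁.strictMonoOn_θ z₁ l₁ h₁.length_pos)
  have i₂ : 0 < θ₂ L₂ - θ₂ 0 := sub_pos.2 (h₂.strictMonoOn_θ z₂ l₂ h₂.length_pos)
  have i₃ : 0 < θ₃ L₃ - θ₃ 0 := sub_pos.2 (h₃.strictMonoOn_θ z₃ l₃ h₃.length_pos)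
  have X₂ := h₂.arcsin_sub_le hm0 hm2 z₂ l₂ h₂.length_pos.le
  rw [hc₂, hc₂', hA'] at X₂
  have h2 : √2 < 3 / 2 := by
    rw [Real.sqrt_lt' (by norm_num)]; norm_num
  have h2' : 0 < √2 := by positivity
  suffices hs : Real.pi ≤ √2 * ((θ₁ L₁ - θ₁ 0) + (θ₂ L₂ - θ₂ 0) + (θ₃ L₃ - θ₃ 0)) by
    have : √2 * ((θ₁ L₁ - θ₁ 0) + (θ₂ L₂ - θ₂ 0) + (θ₃ L₃ - θ₃ 0)) <
        3 / 2 * ((θ₁ L₁ - θ₁ 0) + (θ₂ L₂ - θ₂ 0) + (θ₃ L₃ - θ₃ 0)) :=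
      mul_lt_mul_of_pos_right h2 (by linarith)
    linarith
  -- Of two squared radii with the same energy at Herring ends, one below 1 is the smaller, as y exp
  -- (1 - y) increases up to y = 1.
  have hI : ∀ {x y : ℝ}, x < 1 → x * Real.exp (1 - x) = y * Real.exp (1 - y) → x ≤ y := by
    intro x y hx hxy
    by_contra hlt
    push Not at hlt
    have := strictMonoOn_mul_exp_one_sub (a := y) (b := x) (by simp; linarith) (by simpa using hx.le) hlt
    simp only at this
    linarith
  have k₁ := mul_pos h2' i₁
  have k₂ := mul_pos h2' i₂
  have k₃ := mul_pos h2' i₃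
  -- With A = arcsin (1 / (2m)) ≥ π/6, the middle edge always contributes 2A. If the first twin is
  -- inside the unit circle, the first edge reaches c = -m and climbs back to 1/2, adding π/2 + A;
  -- the total is π/2 + 3A ≥ π.
  rcases lt_or_ge (d₂ 0 ^ 2 + w₂ 0 ^ 2) 1 with ha | ha
  · obtain ⟨s, hs, hsm⟩ := h₁.exists_radialCos_eq_neg_of_radius_le hm0 hm₁ (by rw [hc₁]; norm_num)
      (by rw [hc₁']; norm_num) (hI (by linarith) (by linarith))
    have X₁ := h₁.arcsin_sub_le hm0 hm₁ hs l₁ hs.2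
    rw [hc₁', hsm, hmm'] at X₁
    have := mul_le_mul_of_nonneg_left (h₁.strictMonoOn_θ.monotoneOn z₁ hs hs.1) h2'.le
    linarith
  -- The mirror image of the previous case: the reversed third edge reaches the extreme value.
  rcases lt_or_ge (d₂ L₂ ^ 2 + w₂ L₂ ^ 2) 1 with hb | hb
  · obtain ⟨s, hs, hsm⟩ := h₃.reverse.exists_radialCos_eq_neg_of_radius_le hm0
      (by rw [h₃.energy_reverse, hm₃])
      (by rw [ShrinkerODE.radialCos_reverse, sub_zero, hc₃']; norm_num)
      (by rw [ShrinkerODE.radialCos_reverse, sub_self, hc₃]; norm_num)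
      (by simpa using hI (by linarith) (by linarith))
    have hs' : L₃ - s ∈ Icc 0 L₃ := ⟨by linarith [hs.2], by linarith [hs.1]⟩
    rw [ShrinkerODE.radialCos_reverse, neg_inj] at hsm
    have X₃ := h₃.arcsin_sub_le hm0 hm₃ z₃ hs' hs'.1
    rw [hc₃, hsm, hmm, hA'] at X₃
    have := mul_le_mul_of_nonneg_left (h₃.strictMonoOn_θ.monotoneOn hs' l₃ hs'.2) h2'.le
    linarith
  -- Both twins are at distance at least 1, and the middle edge alone suffices: it attains both -m
  -- and m. If -m comes first, the phase gains π in between; otherwise the initial stretch up to m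
  -- and the final one from -m gain π/2 + A each.
  · obtain ⟨s, hs, hsm⟩ := h₂.exists_radialCos_eq_neg_of_one_le hm0 hm2 (by rw [hc₂]; norm_num)
      (by rw [hc₂']; norm_num) ha
    obtain ⟨t, ht, htm⟩ := h₂.reverse.exists_radialCos_eq_neg_of_one_le hm0
      (by rw [h₂.energy_reverse, hm2])
      (by rw [ShrinkerODE.radialCos_reverse, sub_zero, hc₂']; norm_num)
      (by rw [ShrinkerODE.radialCos_reverse, sub_self, hc₂]; norm_num) (by simpa using hb)
    have ht' : L₂ - t ∈ Icc 0 L₂ := ⟨by linarith [ht.2], by linarith [ht.1]⟩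
    rw [ShrinkerODE.radialCos_reverse, neg_inj] at htm
    rcases le_total s (L₂ - t) with hst | hst
    · have X := h₂.arcsin_sub_le hm0 hm2 hs ht' hst
      rw [hsm, htm, hmm, hmm'] at X
      have e1 := mul_le_mul_of_nonneg_left (h₂.strictMonoOn_θ.monotoneOn z₂ hs hs.1) h2'.le
      have e2 := mul_le_mul_of_nonneg_left (h₂.strictMonoOn_θ.monotoneOn ht' l₂ ht'.2) h2'.le
      linarith
    · have Xa := h₂.arcsin_sub_le hm0 hm2 z₂ ht' ht'.1
      have Xb := h₂.arcsin_sub_le hm0 hm2 hs l₂ hs.2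
      rw [hc₂, htm, hmm, hA'] at Xa
      rw [hc₂', hsm, hmm'] at Xb
      have e1 := mul_le_mul_of_nonneg_left (h₂.strictMonoOn_θ.monotoneOn ht' hs hst) h2'.le
      linarith

/-! ### Shrinking arcs, their conserved quantity and their polar angle -/

/-- A unit speed curve `γ` with unit tangent vector `T` on the interval `D` that satisfies the
shrinker equation `k + γ^⊥ = 0`. -/
structure IsShrinkerArc (γ T : ℝ → ℂ) (D : Set ℝ) : Prop where
  hasDeriv_curve : ∀ s ∈ D, HasDerivWithinAt γ (T s) D s
  hasDeriv_tangent : ∀ s ∈ D,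
    HasDerivWithinAt T (-(γ s - (inner ℝ (T s) (γ s) : ℝ) • T s)) D s
  norm_tangent : ∀ s ∈ D, ‖T s‖ = 1

/-- The oriented area of the parallelogram spanned by `z` and `w`. -/
def crossProd (z w : ℂ) : ℝ := z.re * w.im - z.im * w.re

theorem inner_eq_re_add_im (z w : ℂ) : (inner ℝ z w : ℝ) = z.re * w.re + z.im * w.im := by
  rw [Complex.inner, Complex.mul_re, Complex.conj_re, Complex.conj_im]; ring

theorem inner_sq_add_crossProd_sq (z w : ℂ) :
    (inner ℝ z w : ℝ) ^ 2 + crossProd z w ^ 2 = ‖z‖ ^ 2 * ‖w‖ ^ 2 := by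
  rw [inner_eq_re_add_im, crossProd, Complex.sq_norm, Complex.sq_norm, Complex.normSq_apply,
    Complex.normSq_apply]
  ring

theorem eq_of_hasDerivWithinAt_zero {E : Type*} [NormedAddCommGroup E] [NormedSpace ℝ E]
    {D : Set ℝ} (hD : Convex ℝ D) {f : ℝ → E} (hf : ∀ s ∈ D, HasDerivWithinAt f 0 D s)
    {s t : ℝ} (hs : s ∈ D) (ht : t ∈ D) : f s = f t := by
  have := hD.norm_image_sub_le_of_norm_hasDerivWithin_le hf (C := 0) (by simp) ht hs
  rw [zero_mul] at this
  exact sub_eq_zero.1 (norm_le_zero_iff.1 this)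

theorem HasDerivWithinAt.complex_re {f : ℝ → ℂ} {f' : ℂ} {D : Set ℝ} {s : ℝ}
    (h : HasDerivWithinAt f f' D s) : HasDerivWithinAt (fun s => (f s).re) f'.re D s :=
  Complex.reCLM.hasFDerivAt.comp_hasDerivWithinAt s h

theorem HasDerivWithinAt.complex_im {f : ℝ → ℂ} {f' : ℂ} {D : Set ℝ} {s : ℝ}
    (h : HasDerivWithinAt f f' D s) : HasDerivWithinAt (fun s => (f s).im) f'.im D s :=
  Complex.imCLM.hasFDerivAt.comp_hasDerivWithinAt s h

namespace IsShrinkerArc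

variable {γ T : ℝ → ℂ} {D : Set ℝ}

theorem normSq_tangent (h : IsShrinkerArc γ T D) {s : ℝ} (hs : s ∈ D) :
    (T s).re ^ 2 + (T s).im ^ 2 = 1 := by
  have := Complex.sq_norm (T s)
  rw [h.norm_tangent s hs, Complex.normSq_apply] at this
  linarith

theorem sq_norm_curve (h : IsShrinkerArc γ T D) {s : ℝ} (hs : s ∈ D) :
    (inner ℝ (γ s) (T s) : ℝ) ^ 2 + crossProd (γ s) (T s) ^ 2 = ‖γ s‖ ^ 2 := by
  rw [inner_sq_add_crossProd_sq, h.norm_tangent s hs]; ring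

theorem hasDeriv_inner (h : IsShrinkerArc γ T D) {s : ℝ} (hs : s ∈ D) :
    HasDerivWithinAt (fun s => (inner ℝ (γ s) (T s) : ℝ)) (1 - crossProd (γ s) (T s) ^ 2) D s := by
  have h1 := h.hasDeriv_curve s hs
  have h2 := h.hasDeriv_tangent s hs
  have h3 := h.normSq_tangent hs
  simp_rw [inner_eq_re_add_im]
  refine ((h1.complex_re.mul h2.complex_re).add (h1.complex_im.mul h2.complex_im)).congr_deriv ?_
  simp only [inner_eq_re_add_im, crossProd, Complex.neg_re, Complex.neg_im, Complex.sub_re,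
    Complex.sub_im, Complex.smul_re, Complex.smul_im, smul_eq_mul]
  linear_combination (1 + (γ s).re ^ 2 + (γ s).im ^ 2) * h3

theorem hasDeriv_crossProd (h : IsShrinkerArc γ T D) {s : ℝ} (hs : s ∈ D) :
    HasDerivWithinAt (fun s => crossProd (γ s) (T s))
      (crossProd (γ s) (T s) * inner ℝ (γ s) (T s)) D s := by
  have h1 := h.hasDeriv_curve s hs
  have h2 := h.hasDeriv_tangent s hs
  refine ((h1.complex_re.mul h2.complex_im).sub (h1.complex_im.mul h2.complex_re)).congr_deriv ?_
  simp only [inner_eq_re_add_im, crossProd, Complex.neg_re, Complex.neg_im, Complex.sub_re,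
    Complex.sub_im, Complex.smul_re, Complex.smul_im, smul_eq_mul]
  ring

/-- With X = `crossProd γ T` and d = ⟨γ, T⟩ one has X' = Xd and (‖γ‖²/2)' = d, so the two
contributions to the derivative cancel. Hence X either vanishes identically or keeps its sign. -/
theorem crossProd_mul_exp_eq (h : IsShrinkerArc γ T D) (hD : Convex ℝ D) {s t : ℝ} (hs : s ∈ D)
    (ht : t ∈ D) : crossProd (γ s) (T s) * Real.exp (-(‖γ s‖ ^ 2 / 2)) =
      crossProd (γ t) (T t) * Real.exp (-(‖γ t‖ ^ 2 / 2)) := by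
  rw [← h.sq_norm_curve hs, ← h.sq_norm_curve ht]
  refine eq_of_hasDerivWithinAt_zero hD (f := fun s => crossProd (γ s) (T s) *
    Real.exp (-(((inner ℝ (γ s) (T s) : ℝ) ^ 2 + crossProd (γ s) (T s) ^ 2) / 2))) ?_ hs ht
  intro s hs
  have h1 := h.hasDeriv_inner hs
  have h2 := h.hasDeriv_crossProd hs
  refine (h2.mul ((((h1.pow 2).add (h2.pow 2)).div_const 2).neg.exp)).congr_deriv ?_
  simp
  ring

theorem crossProd_eq_zero (h : IsShrinkerArc γ T D) (hD : Convex ℝ D) {s t : ℝ} (hs : s ∈ D)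
    (ht : t ∈ D) (h0 : crossProd (γ t) (T t) = 0) : crossProd (γ s) (T s) = 0 := by
  have := h.crossProd_mul_exp_eq hD hs ht
  rw [h0, zero_mul] at this
  exact (mul_eq_zero.1 this).resolve_right (Real.exp_pos _).ne'

theorem mul_crossProd_pos (h : IsShrinkerArc γ T D) (hD : Convex ℝ D) {s t σ : ℝ} (hs : s ∈ D)
    (ht : t ∈ D) (h0 : 0 < σ * crossProd (γ t) (T t)) : 0 < σ * crossProd (γ s) (T s) := by
  have h1 := h.crossProd_mul_exp_eq hD hs ht
  have h2 : 0 < σ * crossProd (γ t) (T t) * Real.exp (-(‖γ t‖ ^ 2 / 2)) :=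
    mul_pos h0 (Real.exp_pos _)
  rw [mul_assoc, ← h1, ← mul_assoc] at h2
  exact pos_of_mul_pos_left h2 (Real.exp_pos _).le

/-- A shrinking curve that is tangent to a line through the origin is contained in this line. -/
theorem eq_add_smul (h : IsShrinkerArc γ T D) (hD : Convex ℝ D) {s t : ℝ} (hs : s ∈ D)
    (ht : t ∈ D) (h0 : crossProd (γ t) (T t) = 0) : T s = T t ∧ γ s = γ t + (s - t) • T t := by
  have hT : ∀ s ∈ D, T s = T t := by
    intro s hs
    refine eq_of_hasDerivWithinAt_zero hD (fun s hs => ?_) hs ht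
    refine (h.hasDeriv_tangent s hs).congr_deriv ?_
    have h1 := h.crossProd_eq_zero hD hs ht h0
    have h3 := h.normSq_tangent hs
    rw [crossProd] at h1
    rw [inner_eq_re_add_im]
    apply Complex.ext
    · simp
      linear_combination (γ s).re * h3 - (T s).im * h1
    · simp
      linear_combination (γ s).im * h3 + (T s).re * h1
  refine ⟨hT s hs, ?_⟩
  have : γ s - (s - t) • T t = γ t - (t - t) • T t := by
    refine eq_of_hasDerivWithinAt_zero hD (f := fun s => γ s - (s - t) • T t) (fun s hs => ?_) hs ht
    have h1 := (((hasDerivWithinAt_id s D).sub_const t).smul_const (T t))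
    refine ((h.hasDeriv_curve s hs).sub h1).congr_deriv ?_
    rw [hT s hs]; simp
  rw [sub_self, zero_smul, sub_zero, sub_eq_iff_eq_add] at this
  exact this

/-- A proper shrinking half-line is contained in a line through the origin. -/
theorem crossProd_eq_zero_of_tendsto (h : IsShrinkerArc γ T (Ici 0))
    (hγ : Tendsto γ atTop (cocompact ℂ)) : crossProd (γ 0) (T 0) = 0 := by
  have hn : Tendsto (fun s => ‖γ s‖) atTop atTop := tendsto_norm_cocompact_atTop.comp hγ
  set C := crossProd (γ 0) (T 0) * Real.exp (-(‖γ 0‖ ^ 2 / 2)) with hC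
  -- The cross product is at most r = ‖γ‖ while exp (r²/2) exceeds r²/2, so the conserved quantity
  -- is at most 2/r.
  have hb : ∀ᶠ s in atTop, |C| ≤ 2 * (‖γ s‖)⁻¹ := by
    filter_upwards [eventually_ge_atTop (0 : ℝ), hn.eventually_gt_atTop 0] with s hs hpos
    rw [hC, ← h.crossProd_mul_exp_eq (convex_Ici 0) (s := s) (t := 0) hs self_mem_Ici, abs_mul,
      abs_of_pos (Real.exp_pos _), Real.exp_neg, ← div_eq_mul_inv, ← div_eq_mul_inv]
    have h1 : |crossProd (γ s) (T s)| ≤ ‖γ s‖ := by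
      apply abs_le_of_sq_le_sq _ hpos.le
      nlinarith [h.sq_norm_curve (s := s) hs, sq_nonneg (inner ℝ (γ s) (T s) : ℝ)]
    have h2 := Real.add_one_le_exp (‖γ s‖ ^ 2 / 2)
    rw [div_le_div_iff₀ (Real.exp_pos _) hpos]
    nlinarith
  have hlim : Tendsto (fun s => 2 * (‖γ s‖)⁻¹) atTop (nhds 0) := by
    simpa using hn.inv_tendsto_atTop.const_mul 2
  have h0 : |C| ≤ 0 := ge_of_tendsto hlim hb
  have h1 : C = 0 := abs_eq_zero.1 (le_antisymm h0 (abs_nonneg _))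
  exact (mul_eq_zero.1 h1).resolve_right (Real.exp_pos _).ne'

/-- A shrinking curve that is not contained in a line through the origin winds around the
origin monotonically. -/
theorem exists_angle {L σ : ℝ} (hL : 0 < L) (h : IsShrinkerArc γ T (Icc 0 L)) (hσ : σ ^ 2 = 1)
    (h0 : 0 < σ * crossProd (γ 0) (T 0)) : ∃ θ : ℝ → ℝ, θ 0 = 0 ∧
      ShrinkerODE L (fun s => inner ℝ (γ s) (T s)) (fun s => σ * crossProd (γ s) (T s)) θ ∧
      ∀ a : ℝ, γ 0 = ‖γ 0‖ * Complex.exp (σ * a * Complex.I) → ∀ s ∈ Icc 0 L,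
        γ s = ‖γ s‖ * Complex.exp (σ * (a + θ s : ℝ) * Complex.I) := by
  have z := left_mem_Icc.2 hL.le
  have hw : ∀ s ∈ Icc 0 L, 0 < σ * crossProd (γ s) (T s) :=
    fun s hs => h.mul_crossProd_pos (convex_Icc 0 L) hs z h0
  have hy : ∀ s ∈ Icc 0 L,
      0 < (inner ℝ (γ s) (T s) : ℝ) ^ 2 + (σ * crossProd (γ s) (T s)) ^ 2 := by
    intro s hs
    have := hw s hs
    positivity
  have hd := fun s hs => h.hasDeriv_inner (s := s) hs
  have hc := fun s hs => h.hasDeriv_crossProd (s := s) hs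
  set g : ℝ → ℝ := fun s => σ * crossProd (γ s) (T s) /
    ((inner ℝ (γ s) (T s) : ℝ) ^ 2 + (σ * crossProd (γ s) (T s)) ^ 2) with hg
  have hgc : ContinuousOn g (Icc 0 L) := by
    have c1 : ContinuousOn (fun s => (inner ℝ (γ s) (T s) : ℝ)) (Icc 0 L) :=
      fun s hs => (hd s hs).continuousWithinAt
    have c2 : ContinuousOn (fun s => σ * crossProd (γ s) (T s)) (Icc 0 L) :=
      fun s hs => ((hc s hs).const_mul σ).continuousWithinAt
    exact c2.div ((c1.pow 2).add (c2.pow 2)) (fun s hs => (hy s hs).ne')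
  -- The integrand is extended continuously to the whole line so that its primitive is
  -- differentiable at the end points too.
  have hGc : Continuous (IccExtend hL.le ((Icc 0 L).domRestrict g)) :=
    (continuousOn_iff_continuous_domRestrict.1 hgc).Icc_extend'
  set θ : ℝ → ℝ := fun s => ∫ x in (0 : ℝ)..s, IccExtend hL.le ((Icc 0 L).domRestrict g) x with hθ
  have hθd : ∀ s ∈ Icc 0 L, HasDerivWithinAt θ (g s) (Icc 0 L) s := by
    intro s hs
    have := (hGc.integral_hasStrictDerivAt 0 s).hasDerivAt.hasDerivWithinAt (s := Icc 0 L)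
    rwa [IccExtend_of_mem _ _ hs] at this
  have hODE : ShrinkerODE L (fun s => inner ℝ (γ s) (T s))
      (fun s => σ * crossProd (γ s) (T s)) θ := by
    refine ⟨hL, fun s hs => (hd s hs).congr_deriv ?_, fun s hs =>
      ((hc s hs).const_mul σ).congr_deriv ?_, hθd, hw⟩
    · rw [mul_pow, hσ, one_mul]
    · ring
  refine ⟨θ, by simp [hθ], hODE, fun a ha s hs => ?_⟩
  have hyn : ∀ s ∈ Icc 0 L, (inner ℝ (γ s) (T s) : ℝ) ^ 2 + (σ * crossProd (γ s) (T s)) ^ 2 =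
      ‖γ s‖ ^ 2 := by
    intro s hs
    rw [mul_pow, hσ, one_mul, h.sq_norm_curve hs]
  have hpos : ∀ s ∈ Icc 0 L, 0 < ‖γ s‖ := by
    intro s hs
    have := hy s hs
    rw [hyn s hs] at this
    exact (sq_pos_iff.1 this).lt_of_le' (norm_nonneg _)
  set q : ℝ → ℝ := fun s => √((inner ℝ (γ s) (T s) : ℝ) ^ 2 + (σ * crossProd (γ s) (T s)) ^ 2)
    with hq
  have hqn : ∀ s ∈ Icc 0 L, q s = ‖γ s‖ := by
    intro s hs
    rw [hq]
    simp only
    rw [hyn s hs, Real.sqrt_sq (norm_nonneg _)]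
  -- The unit vector γ/‖γ‖, rotated back by the claimed angle, is constant. The computation rests on
  -- ‖γ‖² T = γ (⟨γ, T⟩ + i X), with X the cross product.
  have hG : ∀ s ∈ Icc 0 L, HasDerivWithinAt (fun s => ((q s)⁻¹ : ℝ) •
      (γ s * Complex.exp (-(σ * (a + θ s : ℝ) * Complex.I)))) 0 (Icc 0 L) s := by
    intro s hs
    have e1 := ((hODE.hasDeriv_radius hs).sqrt (hODE.radius_pos hs).ne')
    have e2 := e1.inv (Real.sqrt_pos.2 (hODE.radius_pos hs)).ne'
    have e3 := (((((hθd s hs).const_add a).ofReal_comp).const_mul (σ : ℂ)).mul_const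
      Complex.I).neg.cexp
    refine (e2.smul ((h.hasDeriv_curve s hs).mul e3)).congr_deriv ?_
    have hpos' := hpos s hs
    have hT : (‖γ s‖ : ℂ) ^ 2 * T s =
        γ s * ((inner ℝ (γ s) (T s) : ℝ) + (crossProd (γ s) (T s) : ℝ) * Complex.I) := by
      rw [← Complex.ofReal_pow, Complex.sq_norm, Complex.normSq_apply]
      apply Complex.ext
      · simp [crossProd]; ring
      · simp [crossProd]; ring
    simp only [Pi.inv_apply, Pi.neg_apply, Pi.mul_apply, hyn s hs, hg,
      Real.sqrt_sq (norm_nonneg (γ s)), Complex.real_smul]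
    have hσ' : (σ : ℂ) ^ 2 = 1 := by exact_mod_cast hσ
    have hn0 : (‖γ s‖ : ℂ) ≠ 0 := by exact_mod_cast hpos'.ne'
    have hT' : T s = γ s * ((inner ℝ (γ s) (T s) : ℝ) + (crossProd (γ s) (T s) : ℝ) *
        Complex.I) / (‖γ s‖ : ℂ) ^ 2 := by
      rw [← hT]; field_simp
    generalize (inner ℝ (γ s) (T s) : ℝ) = d at *
    generalize crossProd (γ s) (T s) = c at *
    rw [hT']
    generalize Complex.exp (-(σ * (a + θ s : ℝ) * Complex.I)) = e
    push_cast
    field_simp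
    linear_combination (-(γ s * e * c * Complex.I)) * hσ'
  have hconst := eq_of_hasDerivWithinAt_zero (convex_Icc 0 L) hG hs z
  simp only [hqn s hs, hqn 0 z] at hconst
  rw [show θ 0 = 0 by simp [hθ], add_zero] at hconst
  have hone : (‖γ 0‖⁻¹ : ℝ) • (γ 0 * Complex.exp (-(σ * a * Complex.I))) = 1 := by
    nth_rw 2 [ha]
    rw [mul_assoc, ← Complex.exp_add, add_neg_cancel, Complex.exp_zero, mul_one,
      Complex.real_smul, ← Complex.ofReal_mul, inv_mul_cancel₀ (hpos 0 z).ne', Complex.ofReal_one]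
  rw [hone, Complex.real_smul, Complex.exp_neg] at hconst
  have hn0 : (‖γ s‖ : ℂ) ≠ 0 := by exact_mod_cast (hpos s hs).ne'
  have he := Complex.exp_ne_zero (σ * (a + θ s : ℝ) * Complex.I)
  push_cast at hconst he ⊢
  field_simp at hconst
  exact hconst

end IsShrinkerArc

/-! ### Polar graphs and the crossing argument -/

/-- The set `K` contains the graph, in polar coordinates, of a positive continuous function of the
angle on the interval `(a, b)`, whose end points are `p` and `q`. The angle is measured
counterclockwise if `σ = 1` and clockwise if `σ = -1`. -/
def HasPolarGraph (σ a b : ℝ) (p q : ℂ) (K : Set ℂ) : Prop :=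
  ∃ R : ℝ → ℝ, ContinuousOn R (Icc a b) ∧ (∀ t ∈ Icc a b, 0 < R t) ∧
    R a * Complex.exp (σ * a * Complex.I) = p ∧ R b * Complex.exp (σ * b * Complex.I) = q ∧
    ∀ t ∈ Ioo a b, R t * Complex.exp (σ * t * Complex.I) ∈ K

theorem norm_ofReal_mul_exp {r : ℝ} (hr : 0 ≤ r) (σ t : ℝ) :
    ‖(r : ℂ) * Complex.exp (σ * t * Complex.I)‖ = r := by
  rw [norm_mul, ← Complex.ofReal_mul, Complex.norm_exp_ofReal_mul_I, Complex.norm_real, mul_one,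
    Real.norm_of_nonneg hr]

theorem ofReal_mul_injective {r r' : ℝ} {z : ℂ} (hz : z ≠ 0) (h : (r : ℂ) * z = r' * z) :
    r = r' := by
  exact_mod_cast mul_right_cancel₀ hz h

theorem HasPolarGraph.trans {σ a b c : ℝ} {p q r : ℂ} {K K' : Set ℂ} (hab : a < b) (hbc : b < c)
    (h : HasPolarGraph σ a b p q K) (h' : HasPolarGraph σ b c q r K') :
    HasPolarGraph σ a c p r (K ∪ {q} ∪ K') := by
  obtain ⟨R, hR, hp, ha, hb, hK⟩ := h
  obtain ⟨R', hR', hp', hb', hc, hK'⟩ := h'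
  have hRR : R b = R' b := ofReal_mul_injective (Complex.exp_ne_zero _) (hb.trans hb'.symm)
  refine ⟨fun t => if t ≤ b then R t else R' t, ?_, ?_, ?_, ?_, ?_⟩
  · have e : Icc a c = Icc a b ∪ Icc b c := (Icc_union_Icc_eq_Icc hab.le hbc.le).symm
    rw [e]
    refine ContinuousOn.union_of_isClosed ?_ ?_ isClosed_Icc isClosed_Icc
    · exact hR.congr fun t ht => if_pos ht.2
    · refine hR'.congr fun t ht => ?_
      split_ifs with h
      · rw [le_antisymm h ht.1, hRR]
      · rfl
  · intro t ht
    simp only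
    split_ifs with h
    · exact hp t ⟨ht.1, h⟩
    · exact hp' t ⟨(not_le.1 h).le, ht.2⟩
  · simp only [if_pos hab.le, ha]
  · simp only [if_neg hbc.not_ge, hc]
  · intro t ht
    simp only
    rcases lt_trichotomy t b with h | h | h
    · rw [if_pos h.le]
      exact Or.inl (Or.inl (hK t ⟨ht.1, h⟩))
    · rw [if_pos h.le, h, hb]
      exact Or.inl (Or.inr rfl)
    · rw [if_neg h.not_ge]
      exact Or.inr (hK' t ⟨h, ht.2⟩)

/-- The angle a + θ is strictly increasing and continuous, so it can serve as the parameter; the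
radius function is ‖γ‖ composed with the inverse. -/
theorem ShrinkerODE.hasPolarGraph {L σ a : ℝ} {d w θ : ℝ → ℝ} {γ : ℝ → ℂ}
    (h : ShrinkerODE L d w θ) (hγ : ContinuousOn γ (Icc 0 L)) (h0 : ∀ s ∈ Icc 0 L, γ s ≠ 0)
    (hθ : θ 0 = 0) (hp : ∀ s ∈ Icc 0 L,
      γ s = ‖γ s‖ * Complex.exp (σ * (a + θ s : ℝ) * Complex.I)) :
    HasPolarGraph σ a (a + θ L) (γ 0) (γ L) (γ '' Ioo 0 L) := by
  have z := left_mem_Icc.2 h.length_pos.le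
  have l := right_mem_Icc.2 h.length_pos.le
  set φ : ℝ → ℝ := fun s => a + θ s with hφ
  have hφm : StrictMonoOn φ (Icc 0 L) := fun s hs t ht hst =>
    (add_lt_add_iff_left a).2 (h.strictMonoOn_θ hs ht hst)
  have hφc : ContinuousOn φ (Icc 0 L) := continuousOn_const.add h.continuousOn_θ
  have hφ0 : φ 0 = a := by simp [hφ, hθ]
  have himg : φ '' Icc 0 L = Icc a (a + θ L) := by
    rw [← hφ0]
    refine Subset.antisymm ?_ (hφ0 ▸ intermediate_value_Icc h.length_pos.le hφc)
    rintro _ ⟨s, hs, rfl⟩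
    exact ⟨hφm.monotoneOn z hs hs.1, by rw [hφ0]; exact hφm.monotoneOn hs l hs.2⟩
  let e := hφm.orderIso
  -- Order connectedness gives the image the order topology, which makes the inverse order
  -- isomorphism continuous.
  have : OrdConnected (φ '' Icc 0 L) := by rw [himg]; exact ordConnected_Icc
  have hc : Continuous fun x : φ '' Icc 0 L => ‖γ (e.symm x)‖ :=
    ((continuousOn_iff_continuous_domRestrict.1 hγ).comp e.symm.continuous).norm
  have hex : ∃ R : ℝ → ℝ, ∀ x : φ '' Icc 0 L, R x = ‖γ (e.symm x)‖ := by
    classical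
    refine ⟨fun t => if ht : t ∈ φ '' Icc 0 L then ‖γ (e.symm ⟨t, ht⟩)‖ else 0, ?_⟩
    rintro ⟨x, hx⟩
    simp only [dif_pos hx]
  obtain ⟨R, hR⟩ := hex
  have hRs : ∀ s ∈ Icc 0 L, R (φ s) = ‖γ s‖ := by
    intro s hs
    have := hR (e ⟨s, hs⟩)
    rw [OrderIso.symm_apply_apply] at this
    exact this
  have hRp : ∀ s ∈ Icc 0 L, R (φ s) * Complex.exp (σ * φ s * Complex.I) = γ s := by
    intro s hs
    rw [hRs s hs, hp s hs, norm_ofReal_mul_exp (norm_nonneg _)]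
  refine ⟨R, ?_, ?_, ?_, ?_, ?_⟩
  · rw [← himg, continuousOn_iff_continuous_domRestrict]
    exact hc.congr fun x => (hR x).symm
  · rw [← himg]
    rintro _ ⟨s, hs, rfl⟩
    rw [hRs s hs]
    exact norm_pos_iff.2 (h0 s hs)
  · rw [← hRp 0 z, hφ0]
  · exact hRp L l
  · intro t ht
    obtain ⟨s, hs, rfl⟩ : t ∈ φ '' Icc 0 L := himg ▸ Ioo_subset_Icc_self ht
    refine ⟨s, ⟨?_, ?_⟩, (hRp s hs).symm⟩
    · refine lt_of_le_of_ne hs.1 ?_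
      rintro rfl
      exact ht.1.ne' hφ0
    · refine lt_of_le_of_ne hs.2 ?_
      rintro rfl
      exact ht.2.ne rfl

/-- Only the two rotations of `u` by ±2π/3 form this angle with it, and `v ≠ w`, so together they
exhaust both. -/
theorem exists_eq_exp_mul {σ : ℝ} (hσ : σ = 1 ∨ σ = -1) {u v w : ℂ} (hu : ‖u‖ = 1) (hv : ‖v‖ = 1)
    (hw : ‖w‖ = 1) (huv : (inner ℝ u v : ℝ) = -1 / 2) (huw : (inner ℝ u w : ℝ) = -1 / 2)
    (hvw : (inner ℝ v w : ℝ) = -1 / 2) :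
    v = Complex.exp (σ * (2 * Real.pi / 3 : ℝ) * Complex.I) * u ∨
      w = Complex.exp (σ * (2 * Real.pi / 3 : ℝ) * Complex.I) * u := by
  have h3 : (√3 : ℝ) ^ 2 = 3 := Real.sq_sqrt (by norm_num)
  have key : ∀ v : ℂ, ‖v‖ = 1 → (inner ℝ u v : ℝ) = -1 / 2 →
      v = (⟨-1 / 2, √3 / 2⟩ : ℂ) * u ∨ v = (⟨-1 / 2, -(√3 / 2)⟩ : ℂ) * u := by
    intro v hv huv
    have h1 := inner_sq_add_crossProd_sq u v
    rw [hu, hv, huv] at h1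
    have h2 : crossProd u v ^ 2 = (√3 / 2) ^ 2 := by linarith
    have hn : u.re ^ 2 + u.im ^ 2 = 1 := by
      have := Complex.sq_norm u
      rw [hu, Complex.normSq_apply] at this
      linarith
    rw [inner_eq_re_add_im] at huv
    rcases sq_eq_sq_iff_eq_or_eq_neg.1 h2 with h | h <;> rw [crossProd] at h
    · left
      apply Complex.ext <;> simp
      · linear_combination (-v.re) * hn + u.re * huv - u.im * h
      · linear_combination (-v.im) * hn + u.im * huv + u.re * h
    · right
      apply Complex.ext <;> simp
      · linear_combination (-v.re) * hn + u.re * huv - u.im * h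
      · linear_combination (-v.im) * hn + u.im * huv + u.re * h
  have hne : v ≠ w := by
    rintro rfl
    rw [real_inner_self_eq_norm_sq, hv] at hvw
    norm_num at hvw
  have hcos : Real.cos (2 * Real.pi / 3) = -1 / 2 := by
    rw [show 2 * Real.pi / 3 = Real.pi - Real.pi / 3 by ring, Real.cos_pi_sub,
      Real.cos_pi_div_three]
    norm_num
  have hsin : Real.sin (2 * Real.pi / 3) = √3 / 2 := by
    rw [show 2 * Real.pi / 3 = Real.pi - Real.pi / 3 by ring, Real.sin_pi_sub,
      Real.sin_pi_div_three]
  have hexp : Complex.exp (σ * (2 * Real.pi / 3 : ℝ) * Complex.I) = ⟨-1 / 2, σ * (√3 / 2)⟩ := by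
    rw [← Complex.ofReal_mul]
    apply Complex.ext
    · rw [Complex.exp_ofReal_mul_I_re]
      rcases hσ with rfl | rfl
      · rw [one_mul, hcos]
      · rw [neg_one_mul, Real.cos_neg, hcos]
    · rw [Complex.exp_ofReal_mul_I_im]
      rcases hσ with rfl | rfl
      · rw [one_mul, hsin, one_mul]
      · rw [neg_one_mul, Real.sin_neg, hsin, neg_one_mul]
  rw [hexp]
  rcases hσ with rfl | rfl
  · rw [one_mul]
    rcases key v hv huv with h | h
    · exact Or.inl h
    · rcases key w hw huw with h' | h'
      · exact Or.inr h'
      · exact absurd (h.trans h'.symm) hne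
  · rw [neg_one_mul]
    rcases key v hv huv with h | h
    · rcases key w hw huw with h' | h'
      · exact absurd (h.trans h'.symm) hne
      · exact Or.inr h'
    · exact Or.inl h

/-- Three disjoint curves that run around the origin in the same direction from the end of one
spoke to the end of the next one, and that do not meet the three spokes, cannot all turn by more
than `2π/3`. -/
theorem false_of_hasPolarGraph {σ : ℝ} (hσ : σ = 1 ∨ σ = -1) (ℓ : ZMod 3 → ℝ) (u : ZMod 3 → ℂ)
    (K : ZMod 3 → Set ℂ) (Δ : ZMod 3 → ℝ) (hℓ : ∀ i, 0 < ℓ i) (hu : ∀ i, ‖u i‖ = 1)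
    (huu : ∀ i j, i ≠ j → (inner ℝ (u i) (u j) : ℝ) = -1 / 2) (hΔ : ∀ i, 2 * Real.pi / 3 < Δ i)
    (hgraph : ∀ i, ∀ a : ℝ, u i = Complex.exp (σ * a * Complex.I) →
      HasPolarGraph σ a (a + Δ i) (ℓ i * u i) (ℓ (i + 1) * u (i + 1)) (K i))
    (hspoke : ∀ i j, ∀ r ∈ Icc 0 (ℓ j), (r : ℂ) * u j ∉ K i)
    (hdisj : ∀ i j, i ≠ j → Disjoint (K i) (K j)) : False := by
  -- Take the path that turns least. The path starting at the next spoke in the direction σ begins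
  -- 2π/3 later, so it is still running when path `i` ends.
  obtain ⟨i, hmin⟩ := Finite.exists_min Δ
  have hpi := Real.pi_pos
  obtain ⟨j, hij, hj⟩ : ∃ j, i ≠ j ∧
      u j = Complex.exp (σ * (2 * Real.pi / 3 : ℝ) * Complex.I) * u i := by
    have h : ∀ i : ZMod 3, i ≠ i + 1 ∧ i ≠ i + 2 ∧ i + 1 ≠ i + 2 := by decide
    obtain ⟨h1, h2, h3⟩ := h i
    rcases exists_eq_exp_mul hσ (hu i) (hu _) (hu _) (huu _ _ h1) (huu _ _ h2) (huu _ _ h3)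
      with h | h
    · exact ⟨_, h1, h⟩
    · exact ⟨_, h2, h⟩
  obtain ⟨a, ha⟩ : ∃ a : ℝ, u i = Complex.exp (σ * a * Complex.I) := by
    have h1 : u i = Complex.exp ((u i).arg * Complex.I) := by
      have := Complex.norm_mul_exp_arg_mul_I (u i)
      rw [hu i, Complex.ofReal_one, one_mul] at this
      exact this.symm
    rcases hσ with rfl | rfl
    · exact ⟨(u i).arg, by simpa using h1⟩
    · exact ⟨-(u i).arg, by simpa using h1⟩
  set a' := a + 2 * Real.pi / 3 with ha'
  have hj' : u j = Complex.exp (σ * a' * Complex.I) := by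
    rw [hj, ha, ← Complex.exp_add, ha']
    congr 1
    push_cast
    ring
  obtain ⟨R, hR, hRp, hRa, hRb, hRK⟩ := hgraph i a ha
  obtain ⟨R', hR', hRp', hRa', hRb', hRK'⟩ := hgraph j a' hj'
  have hΔi := hΔ i
  have hm := hmin j
  have hout : ∀ (r : ℝ) (i j : ZMod 3), 0 < r → (r : ℂ) * u j ∈ K i → ℓ j < r := by
    intro r i j hr hmem
    by_contra hle
    exact hspoke i j r ⟨hr.le, not_lt.1 hle⟩ hmem
  set b := a + Δ i with hb
  have hab : a' < b := by linarith
  -- at the angle `a'`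
  have h1 : R' a' < R a' := by
    have e : R' a' = ℓ j := by
      rw [← hj'] at hRa'
      exact ofReal_mul_injective (norm_ne_zero_iff.1 (by rw [hu]; norm_num)) hRa'
    rw [e]
    refine hout _ i j (hRp a' ⟨by linarith, hab.le⟩) ?_
    rw [hj']
    exact hRK a' ⟨by linarith, hab⟩
  -- at the angle `b`
  have h2 : R b < R' b := by
    have hbmem : b ∈ Icc a b := ⟨by linarith, le_rfl⟩
    have hn := norm_ofReal_mul_exp (hRp b hbmem).le σ b
    rw [hRb, norm_mul, hu, mul_one, Complex.norm_real, Real.norm_of_nonneg (hℓ _).le] at hn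
    have hub : u (i + 1) = Complex.exp (σ * b * Complex.I) := by
      rw [← hn] at hRb
      have : (ℓ (i + 1) : ℂ) ≠ 0 := by exact_mod_cast (hℓ (i + 1)).ne'
      exact (mul_left_cancel₀ this hRb).symm
    rw [← hn]
    refine hout _ j (i + 1) (hRp' b ⟨hab.le, by linarith⟩) ?_
    rw [hub]
    exact hRK' b ⟨hab, by linarith⟩
  have hcont : ContinuousOn (fun t => R' t - R t) (Icc a' b) :=
    (hR'.mono (Icc_subset_Icc_right (by linarith))).sub
      (hR.mono (Icc_subset_Icc_left (by linarith)))
  -- At `a'` path `i` passes beyond the tip of spoke `j`, where path `j` starts; at `b` path `j`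
  -- passes beyond the tip where path `i` ends. In between the radii agree.
  obtain ⟨t, ht, ht0⟩ := intermediate_value_Ioo hab.le hcont
    (show (0 : ℝ) ∈ Ioo _ _ from ⟨sub_neg.2 h1, sub_pos.2 h2⟩)
  have e : R' t = R t := sub_eq_zero.1 ht0
  refine (disjoint_left.1 (hdisj i j hij)) (hRK t ⟨by linarith [ht.1], ht.2⟩) ?_
  rw [← e]
  exact hRK' t ⟨ht.1, by linarith [ht.2]⟩

/-! ### Networks near their points, and the rotation of junctions -/

theorem inner_mul_norm_sq (z w p : ℂ) : (inner ℝ z w : ℝ) * ‖p‖ ^ 2 =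
    inner ℝ p z * inner ℝ p w + crossProd p z * crossProd p w := by
  simp only [inner_eq_re_add_im, crossProd, Complex.sq_norm, Complex.normSq_apply]
  ring

/-- Only the zero vector is parallel to two unit vectors at the Herring angle. -/
theorem eq_zero_of_crossProd_eq_zero {z w p : ℂ} (hz : ‖z‖ = 1) (hw : ‖w‖ = 1)
    (hzw : (inner ℝ z w : ℝ) = -1 / 2) (h1 : crossProd p z = 0) (h2 : crossProd p w = 0) :
    p = 0 := by
  have e := inner_mul_norm_sq z w p
  have e1 := inner_sq_add_crossProd_sq p z
  have e2 := inner_sq_add_crossProd_sq p w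
  rw [h1, hz] at e1
  rw [h2, hw] at e2
  rw [h1, hzw] at e
  have e3 : (inner ℝ p z * inner ℝ p w : ℝ) ^ 2 = ‖p‖ ^ 2 * ‖p‖ ^ 2 := by
    rw [mul_pow]
    rw [show (inner ℝ p z : ℝ) ^ 2 = ‖p‖ ^ 2 by linarith,
      show (inner ℝ p w : ℝ) ^ 2 = ‖p‖ ^ 2 by linarith]
  rw [show (inner ℝ p z * inner ℝ p w : ℝ) = -1 / 2 * ‖p‖ ^ 2 by linarith] at e3
  have e4 : (‖p‖ ^ 2) ^ 2 = 0 := by linarith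
  exact norm_eq_zero.1 (pow_eq_zero_iff (two_ne_zero) |>.1 (pow_eq_zero_iff (two_ne_zero) |>.1 e4))

theorem abs_crossProd_le (z w : ℂ) : |crossProd z w| ≤ ‖z‖ * ‖w‖ := by
  apply abs_le_of_sq_le_sq _ (by positivity)
  rw [mul_pow, ← inner_sq_add_crossProd_sq]
  exact le_add_of_nonneg_left (sq_nonneg _)

section Domain

variable {E R : Type} {length : E → ℝ}

theorem curveDomain_inl (e : E) :
    curveDomain length (Sum.inl e : E ⊕ R) = Icc 0 (length e) := rfl

theorem curveDomain_inr (r : R) : curveDomain length (Sum.inr r : E ⊕ R) = Ici 0 := rfl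

theorem convex_curveDomain (c : E ⊕ R) : Convex ℝ (curveDomain length c) := by
  rcases c with e | r
  · exact convex_Icc _ _
  · exact convex_Ici _

theorem uniqueDiffOn_curveDomain (hl : ∀ e, 0 < length e) (c : E ⊕ R) :
    UniqueDiffOn ℝ (curveDomain length c) := by
  rcases c with e | r
  · exact uniqueDiffOn_Icc (hl e)
  · exact uniqueDiffOn_Ici 0

theorem zero_mem_curveDomain (hl : ∀ e, 0 < length e) (c : E ⊕ R) :
    (0 : ℝ) ∈ curveDomain length c := by
  rcases c with e | r
  · exact left_mem_Icc.2 (hl e).le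
  · exact self_mem_Ici

theorem curveDomain_mem_nhdsGE (hl : ∀ e, 0 < length e) (c : E ⊕ R) :
    curveDomain length c ∈ nhdsWithin (0 : ℝ) (Ici 0) := by
  rcases c with e | r
  · exact Icc_mem_nhdsGE (hl e)
  · exact self_mem_nhdsWithin

end Domain

namespace Network

variable {V E R : Type} {G : RayGraph V E R} (N : Network G)

theorem convex_dom (c : E ⊕ R) : Convex ℝ (N.dom c) := convex_curveDomain c

theorem zero_mem_dom (c : E ⊕ R) : (0 : ℝ) ∈ N.dom c := zero_mem_curveDomain N.length_pos c

theorem length_mem_dom (e : E) : N.length e ∈ N.dom (Sum.inl e) :=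
  right_mem_Icc.2 (N.length_pos e).le

theorem hasDerivWithinAt_curve (c : E ⊕ R) {s : ℝ} (hs : s ∈ N.dom c) :
    HasDerivWithinAt (N.curve c) (N.tangent c s) (N.dom c) s :=
  ((N.contDiffOn c).differentiableOn (by norm_num) s hs).hasDerivWithinAt

theorem continuousOn_curve (c : E ⊕ R) : ContinuousOn (N.curve c) (N.dom c) :=
  (N.contDiffOn c).continuousOn

theorem norm_tangent (c : E ⊕ R) {s : ℝ} (hs : s ∈ N.dom c) : ‖N.tangent c s‖ = 1 :=
  N.unit_speed c s hs

variable {N} in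
theorem IsRegularShrinker.isShrinkerArc (h : N.IsRegularShrinker) (c : E ⊕ R) :
    IsShrinkerArc (N.curve c) (N.tangent c) (N.dom c) := by
  refine ⟨fun s hs => N.hasDerivWithinAt_curve c hs, fun s hs => ?_,
    fun s hs => N.norm_tangent c hs⟩
  have h1 : ContDiffOn ℝ 1 (N.tangent c) (N.dom c) :=
    (N.contDiffOn c).derivWithin (uniqueDiffOn_curveDomain N.length_pos c) (by norm_num)
  have h2 := (h1.differentiableOn (by norm_num) s hs).hasDerivWithinAt
  have h3 := h.2 c s hs
  rwa [show derivWithin (N.tangent c) (N.dom c) s = -N.normalPosition c s from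
    eq_neg_of_add_eq_zero_left h3] at h2

/-- The parametrization of a curve of the network that starts from one of its ends. -/
def endCurve : G.End → ℝ → ℂ :=
  Sum.elim (fun c => N.curve c) (fun e t => N.curve (Sum.inl e) (N.length e - t))

theorem endCurve_zero (d : G.End) : N.endCurve d 0 = N.pos (G.endVertex d) := by
  rcases d with (e | r) | e
  · exact N.edge_src e
  · exact N.ray_base r
  · simpa [endCurve, RayGraph.endVertex] using N.edge_tgt e

theorem endCurve_mem_support (d : G.End) :
    ∀ᶠ t in nhdsWithin (0 : ℝ) (Ici 0), N.endCurve d t ∈ N.support := by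
  rcases d with c | e
  · filter_upwards [curveDomain_mem_nhdsGE N.length_pos c] with t ht
    exact mem_iUnion.2 ⟨c, mem_image_of_mem _ ht⟩
  · filter_upwards [Icc_mem_nhdsGE (N.length_pos e)] with t ht
    exact mem_iUnion.2 ⟨Sum.inl e, mem_image_of_mem _
      (show N.length e - t ∈ Icc 0 (N.length e) from ⟨by linarith [ht.2], by linarith [ht.1]⟩)⟩

theorem hasDerivWithinAt_endCurve (d : G.End) :
    HasDerivWithinAt (N.endCurve d) (N.endTangent d) (Ici 0) 0 := by
  rcases d with c | e
  · exact (N.hasDerivWithinAt_curve c (N.zero_mem_dom c)).mono_of_mem_nhdsWithin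
      (curveDomain_mem_nhdsGE N.length_pos c)
  · have h1 : HasDerivWithinAt (N.curve (Sum.inl e)) (N.tangent (Sum.inl e) (N.length e))
        (Icc 0 (N.length e)) (N.length e - 0) := by
      rw [sub_zero]
      exact N.hasDerivWithinAt_curve (Sum.inl e) (N.length_mem_dom e)
    have h2 := h1.scomp (h := fun t => N.length e - t) 0
      ((hasDerivWithinAt_id (0 : ℝ) (Icc 0 (N.length e))).const_sub (N.length e))
      (fun t ht => ⟨by linarith [ht.2], by linarith [ht.1]⟩)
    exact (h2.congr_deriv (by simp [endTangent])).mono_of_mem_nhdsWithin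
      (Icc_mem_nhdsGE (N.length_pos e))

theorem norm_endTangent (d : G.End) : ‖N.endTangent d‖ = 1 := by
  rcases d with c | e
  · exact N.norm_tangent c (N.zero_mem_dom c)
  · rw [endTangent, Sum.elim_inr, norm_neg]
    exact N.norm_tangent _ (N.length_mem_dom e)

variable {N} in
theorem IsRegular.inner_endTangent (h : N.IsRegular) {d d' : G.End} (hne : d ≠ d')
    (hv : G.endVertex d = G.endVertex d') :
    (inner ℝ (N.endTangent d) (N.endTangent d') : ℝ) = -1 / 2 := by
  have h1 := InnerProductGeometry.cos_angle_mul_norm_mul_norm (N.endTangent d) (N.endTangent d')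
  rw [h.2 d d' hne hv, N.norm_endTangent, N.norm_endTangent, mul_one, mul_one,
    show 2 * Real.pi / 3 = Real.pi - Real.pi / 3 by ring, Real.cos_pi_sub,
    Real.cos_pi_div_three] at h1
  linarith

variable {N} in
theorem IsRegular.exists_ends (h : N.IsRegular) (v : V) :
    ∃ d d' : G.End, d ≠ d' ∧ G.endVertex d = v ∧ G.endVertex d' = v := by
  have h1 := h.1 v
  have hf : Finite {d : G.End // G.endVertex d = v} := Nat.finite_of_card_ne_zero (by omega)
  have hn : Nontrivial {d : G.End // G.endVertex d = v} := by
    rw [← Finite.one_lt_card_iff_nontrivial]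
    omega
  obtain ⟨⟨d, hd⟩, ⟨d', hd'⟩, hne⟩ := hn
  exact ⟨d, d', fun h => hne (Subtype.ext h), hd, hd'⟩

/-- Images of compact parameter sets are closed. On a ray, properness keeps the tail out of a unit
ball about `q`, which leaves only a compact part. -/
theorem eventually_notMem_image (c : E ⊕ R) {A : Set ℝ} (hA : IsClosed A) {q : ℂ}
    (hq : q ∉ N.curve c '' (N.dom c ∩ A)) : ∀ᶠ p in nhds q, p ∉ N.curve c '' (N.dom c ∩ A) := by
  have hcpt : ∀ B : Set ℝ, IsCompact B → B ⊆ N.dom c → q ∉ N.curve c '' B →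
      ∀ᶠ p in nhds q, p ∉ N.curve c '' B := fun B hB hs hq =>
    (hB.image_of_continuousOn ((N.continuousOn_curve c).mono hs)).isClosed.isOpen_compl.mem_nhds hq
  rcases c with e | r
  · exact hcpt _ (isCompact_Icc.inter_right hA) inter_subset_left hq
  · have h1 := (N.ray_proper r).eventually (isCompact_closedBall q 1).compl_mem_cocompact
    obtain ⟨M, hM⟩ := eventually_atTop.1 h1
    have h2 := hcpt (Icc 0 M ∩ A) (isCompact_Icc.inter_right hA)
      (fun s hs => hs.1.1) (fun hmem => hq (image_mono
        (inter_subset_inter_left A fun s hs => hs.1) hmem))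
    filter_upwards [h2, Metric.closedBall_mem_nhds q one_pos] with p hp hball
    rintro ⟨s, ⟨hs, hsA⟩, rfl⟩
    rcases le_total s M with h | h
    · exact hp ⟨s, ⟨⟨hs, h⟩, hsA⟩, rfl⟩
    · exact hM s h hball

/-- Near an interior point of a curve, the network consists of a short piece of this curve. -/
theorem eventually_mem_of_interior [Finite E] [Finite R] {c : E ⊕ R} {s : ℝ}
    (hs : s ∈ interior (N.dom c)) {δ : ℝ} (hδ : 0 < δ) :
    ∀ᶠ q in nhds (N.curve c s), q ∈ N.support →
      ∃ s' ∈ N.dom c, |s' - s| < δ ∧ N.curve c s' = q := by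
  -- For `c' = c` the condition selects the parameters at distance at least δ from `s`; for any
  -- other curve it is vacuous and the whole curve is excluded.
  have hev : ∀ c', ∀ᶠ q in nhds (N.curve c s),
      q ∉ N.curve c' '' (N.dom c' ∩ {s' | c' = c → δ ≤ |s' - s|}) := by
    intro c'
    apply N.eventually_notMem_image
    · by_cases h : c' = c
      · simp only [h, forall_const]
        exact isClosed_le continuous_const (continuous_id.sub continuous_const).abs
      · simp [h]
    · rintro ⟨s', ⟨hs', hA⟩, heq⟩
      obtain ⟨rfl, rfl⟩ := N.embedded c c' s s' hs hs' heq.symm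
      have := hA rfl
      rw [sub_self, abs_zero] at this
      linarith
  filter_upwards [eventually_all.2 hev] with q hq hmem
  obtain ⟨c', s', hs', rfl⟩ := mem_iUnion.1 hmem
  have h1 : ¬ (c' = c → δ ≤ |s' - s|) := fun h => hq c' ⟨s', ⟨hs', h⟩, rfl⟩
  push Not at h1
  obtain ⟨rfl, h2⟩ := h1
  exact ⟨s', hs', h2, rfl⟩

/-- At an interior point of a curve, the network is tangent to this curve. -/
theorem crossProd_isLittleO [Finite E] [Finite R] {c : E ⊕ R} {s : ℝ}
    (hs : s ∈ interior (N.dom c)) :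
    (fun q => crossProd (N.tangent c s) (q - N.curve c s))
      =o[nhdsWithin (N.curve c s) N.support] fun q => q - N.curve c s := by
  rw [Asymptotics.isLittleO_iff]
  intro ε hε
  set η := min (ε / 2) (1 / 2) with hη
  have hη0 : 0 < η := by positivity
  have hη1 : η ≤ ε / 2 := min_le_left _ _
  have hη2 : η ≤ 1 / 2 := min_le_right _ _
  have hs' := interior_subset hs
  have hT := N.norm_tangent c hs'
  have hder := (N.hasDerivWithinAt_curve c hs').hasDerivAt (mem_interior_iff_mem_nhds.1 hs)
  have hlo := (Asymptotics.isLittleO_iff.1 hder.isLittleO) hη0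
  obtain ⟨δ, hδ, hball⟩ := Metric.eventually_nhds_iff.1 hlo
  filter_upwards [nhdsWithin_le_nhds (N.eventually_mem_of_interior hs hδ), self_mem_nhdsWithin]
    with q hq hmem
  obtain ⟨s', -, hlt, rfl⟩ := hq hmem
  have h1 := hball (y := s') (by rwa [Real.dist_eq])
  set T := N.tangent c s
  set z := N.curve c s' - N.curve c s with hz
  have h2 : crossProd T z = crossProd T (z - (s' - s) • T) := by
    simp [crossProd]; ring
  have h3 : ‖(s' - s) • T‖ = ‖s' - s‖ := by rw [norm_smul, hT, mul_one]
  have h4 : ‖s' - s‖ ≤ ‖z‖ + ‖z - (s' - s) • T‖ := by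
    rw [← h3, norm_sub_rev z]
    have := norm_add_le z ((s' - s) • T - z)
    rwa [add_sub_cancel] at this
  have h5 := abs_crossProd_le T (z - (s' - s) • T)
  rw [hT, one_mul] at h5
  rw [Real.norm_eq_abs, h2]
  have h6 : ‖s' - s‖ ≤ 2 * ‖z‖ := by
    have := mul_le_mul_of_nonneg_right hη2 (norm_nonneg (s' - s))
    linarith
  calc |crossProd T (z - (s' - s) • T)| ≤ η * ‖s' - s‖ := h5.trans h1
    _ ≤ ε / 2 * (2 * ‖z‖) := mul_le_mul hη1 h6 (norm_nonneg _) (by positivity)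
    _ = ε * ‖z‖ := by ring

/-- The component of `f` normal to the curve has the one-sided derivative `crossProd T v`, but also
0 because it is of smaller order than the displacement. One-sided derivatives are unique. -/
theorem crossProd_eq_zero_of_hasDerivWithinAt [Finite E] [Finite R] {c : E ⊕ R} {s : ℝ}
    (hs : s ∈ interior (N.dom c)) {f : ℝ → ℂ} {v : ℂ} (hf : HasDerivWithinAt f v (Ici 0) 0)
    (hf0 : f 0 = N.curve c s) (hmem : ∀ᶠ t in nhdsWithin (0 : ℝ) (Ici 0), f t ∈ N.support) :
    crossProd (N.tangent c s) v = 0 := by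
  set T := N.tangent c s
  have h1 : HasDerivWithinAt (fun t => crossProd T (f t - N.curve c s)) (crossProd T v) (Ici 0) 0 :=
    ((hf.sub_const _).complex_im.const_mul T.re).sub ((hf.sub_const _).complex_re.const_mul T.im)
  have htend : Tendsto f (nhdsWithin 0 (Ici 0)) (nhdsWithin (N.curve c s) N.support) := by
    refine tendsto_nhdsWithin_iff.2 ⟨?_, hmem⟩
    rw [← hf0]
    exact hf.continuousWithinAt
  have h2 := (N.crossProd_isLittleO hs).comp_tendsto htend
  have h3 : (fun t => f t - N.curve c s) =O[nhdsWithin 0 (Ici 0)] fun t : ℝ => t - 0 := by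
    rw [← hf0]
    exact hf.hasFDerivWithinAt.isBigO_sub
  have h4 : HasDerivWithinAt (fun t => crossProd T (f t - N.curve c s)) 0 (Ici 0) 0 := by
    rw [hasDerivWithinAt_iff_isLittleO]
    simpa [hf0, crossProd, Function.comp_def] using h2.trans_isBigO h3
  exact (uniqueDiffOn_Ici (0 : ℝ) 0 self_mem_Ici).eq_deriv _ h1 h4

theorem mem_interior_or_eq_pos (c : E ⊕ R) {s : ℝ} (hs : s ∈ N.dom c) :
    s ∈ interior (N.dom c) ∨ ∃ v, N.curve c s = N.pos v := by
  rcases c with e | r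
  · rcases eq_endpoints_or_mem_Ioo_of_mem_Icc hs with rfl | rfl | h
    · exact Or.inr ⟨_, N.edge_src e⟩
    · exact Or.inr ⟨_, N.edge_tgt e⟩
    · exact Or.inl (by rw [dom, curveDomain_inl, interior_Icc]; exact h)
  · rcases (show (0 : ℝ) ≤ s from hs).eq_or_lt with rfl | h
    · exact Or.inr ⟨_, N.ray_base r⟩
    · exact Or.inl (by rw [dom, curveDomain_inr, interior_Ici]; exact h)

variable {N} in
/-- A rotation about the origin that preserves a regular network permutes its junctions. -/
theorem IsRegular.exists_pos_eq [Finite E] [Finite R] (h : N.IsRegular) {ω : ℂ} (hω : ‖ω‖ = 1)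
    (hsym : (fun z : ℂ => ω * z) '' N.support = N.support) (v : V) :
    ∃ v', N.pos v' = ω * N.pos v := by
  have hrot : ∀ p ∈ N.support, ω * p ∈ N.support := fun p hp => by
    rw [← hsym]; exact mem_image_of_mem _ hp
  obtain ⟨d, d', hne, hd, hd'⟩ := h.exists_ends v
  have hp : N.pos v ∈ N.support := by
    have := (N.endCurve_mem_support d).self_of_nhdsWithin self_mem_Ici
    rwa [endCurve_zero, hd] at this
  obtain ⟨c, s, hs, hcs⟩ := mem_iUnion.1 (hrot _ hp)
  rcases N.mem_interior_or_eq_pos c hs with hint | ⟨v', hv'⟩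
  -- If a junction were rotated to an interior point of a curve, two directions at angle 2π/3 would
  -- both be tangent to that curve, forcing its tangent vector to be 0.
  · exfalso
    have key : ∀ d : G.End, G.endVertex d = v →
        crossProd (N.tangent c s) (ω * N.endTangent d) = 0 := by
      intro d hd
      refine N.crossProd_eq_zero_of_hasDerivWithinAt hint
        ((N.hasDerivWithinAt_endCurve d).const_mul ω) ?_ ?_
      · rw [endCurve_zero, hd, hcs]
      · filter_upwards [N.endCurve_mem_support d] with t ht
        exact hrot _ ht
    have hin : (inner ℝ (ω * N.endTangent d) (ω * N.endTangent d') : ℝ) = -1 / 2 := by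
      rw [← h.inner_endTangent hne (hd.trans hd'.symm)]
      have := Complex.sq_norm ω
      rw [hω, Complex.normSq_apply] at this
      simp only [inner_eq_re_add_im, Complex.mul_re, Complex.mul_im]
      linear_combination (-((N.endTangent d).re * (N.endTangent d').re +
        (N.endTangent d).im * (N.endTangent d').im)) * this
    have h0 := eq_zero_of_crossProd_eq_zero (by rw [norm_mul, hω, norm_endTangent, one_mul])
      (by rw [norm_mul, hω, norm_endTangent, one_mul]) hin (key d hd) (key d' hd')
    have h1 := N.norm_tangent c hs
    rw [h0, norm_zero] at h1
    exact zero_ne_one h1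
  · exact ⟨v', by rw [← hv', hcs]⟩

/-- The vertices and the open curves of a network. -/
def piece : V ⊕ (E ⊕ R) → Set ℂ :=
  Sum.elim (fun v => {N.pos v}) (fun c => N.curve c '' interior (N.dom c))

-- Embeddedness speaks only of points of curves. Regularity provides a curve ending at `v`, and its
-- end parameter would have to coincide with an interior one.
variable {N} in
theorem IsRegular.curve_ne_pos (h : N.IsRegular) {c : E ⊕ R} {s : ℝ}
    (hs : s ∈ interior (N.dom c)) (v : V) : N.curve c s ≠ N.pos v := by
  intro heq
  obtain ⟨d, -, -, hd, -⟩ := h.exists_ends v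
  rcases d with c' | e
  · have h0 := N.endCurve_zero (Sum.inl c')
    rw [hd, ← heq] at h0
    obtain ⟨rfl, rfl⟩ := N.embedded c c' s 0 hs (N.zero_mem_dom c') h0.symm
    rcases c with e | r
    · rw [dom, curveDomain_inl, interior_Icc] at hs
      exact lt_irrefl _ hs.1
    · rw [dom, curveDomain_inr, interior_Ici] at hs
      exact lt_irrefl (0 : ℝ) (mem_Ioi.1 hs)
  · have h0 : N.curve (Sum.inl e) (N.length e) = N.curve c s := by
      rw [N.edge_tgt, heq, ← hd]; rfl
    obtain ⟨rfl, rfl⟩ := N.embedded c (Sum.inl e) s _ hs (N.length_mem_dom e) h0.symm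
    rw [dom, curveDomain_inl, interior_Icc] at hs
    exact lt_irrefl _ hs.2

variable {N} in
theorem IsRegular.eq_of_mem_piece (h : N.IsRegular) {x y : V ⊕ (E ⊕ R)} {p : ℂ}
    (hx : p ∈ N.piece x) (hy : p ∈ N.piece y) : x = y := by
  rcases x with v | c <;> rcases y with v' | c'
  · rw [N.pos_injective ((Set.mem_singleton_iff.1 hx).symm.trans hy)]
  · obtain ⟨s, hs, rfl⟩ := hy
    exact absurd hx (h.curve_ne_pos hs v)
  · obtain ⟨s, hs, rfl⟩ := hx
    exact absurd hy (h.curve_ne_pos hs v')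
  · obtain ⟨s, hs, rfl⟩ := hx
    obtain ⟨s', hs', heq⟩ := hy
    rw [(N.embedded c c' s s' hs (interior_subset hs') heq.symm).1]

end Network

/-! ### Consequences of the Herring condition for shrinkers -/

namespace Network

variable {V E R : Type} {G : RayGraph V E R} {N : Network G}

/-- Two ends of curves at the same junction are both tangent to the radial direction only at the
origin. -/
theorem IsRegular.pos_eq_zero (h : N.IsRegular) {d d' : G.End} (hne : d ≠ d')
    (hv : G.endVertex d = G.endVertex d')
    (h1 : crossProd (N.pos (G.endVertex d)) (N.endTangent d) = 0)
    (h2 : crossProd (N.pos (G.endVertex d)) (N.endTangent d') = 0) :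
    N.pos (G.endVertex d) = 0 :=
  eq_zero_of_crossProd_eq_zero (N.norm_endTangent d) (N.norm_endTangent d')
    (h.inner_endTangent hne hv) h1 h2

theorem IsRegularShrinker.crossProd_ray (h : N.IsRegularShrinker) (r : R) :
    crossProd (N.pos (G.base r)) (N.tangent (Sum.inr r) 0) = 0 := by
  rw [← N.ray_base r]
  exact (h.isShrinkerArc (Sum.inr r)).crossProd_eq_zero_of_tendsto (N.ray_proper r)

theorem IsRegularShrinker.crossProd_src_eq_zero_iff (h : N.IsRegularShrinker) (e : E) :
    crossProd (N.pos (G.src e)) (N.tangent (Sum.inl e) 0) = 0 ↔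
      crossProd (N.pos (G.tgt e)) (N.tangent (Sum.inl e) (N.length e)) = 0 := by
  rw [← N.edge_src e, ← N.edge_tgt e]
  have ha := h.isShrinkerArc (Sum.inl e)
  exact ⟨ha.crossProd_eq_zero (N.convex_dom _) (N.length_mem_dom e) (N.zero_mem_dom _),
    ha.crossProd_eq_zero (N.convex_dom _) (N.zero_mem_dom _) (N.length_mem_dom e)⟩

/-- If an edge issues from the origin, no ray starts at its terminal vertex. -/
theorem IsRegularShrinker.pos_src_ne_zero (h : N.IsRegularShrinker) {e : E} {r : R}
    (hr : G.base r = G.tgt e) (hne : G.src e ≠ G.tgt e) : N.pos (G.src e) ≠ 0 := by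
  intro h0
  have h1 : crossProd (N.pos (G.src e)) (N.tangent (Sum.inl e) 0) = 0 := by
    simp [h0, crossProd]
  -- An edge through the origin is radial up to its other end, where the ray is radial too; so that
  -- end would be the origin as well.
  rw [h.crossProd_src_eq_zero_iff] at h1
  have h2 := h.crossProd_ray r
  refine hne (N.pos_injective ?_)
  rw [h0]
  refine (h.1.pos_eq_zero (d := Sum.inr e) (d' := Sum.inl (Sum.inr r)) (by simp) hr.symm
    ?_ ?_).symm
  · simp only [crossProd, endTangent, RayGraph.endVertex, Sum.elim_inr, Complex.neg_re,
      Complex.neg_im] at h1 ⊢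
    linarith
  · rw [hr] at h2
    exact h2

/-- If an edge ends at the origin, no ray starts at its initial vertex. -/
theorem IsRegularShrinker.pos_tgt_ne_zero (h : N.IsRegularShrinker) {e : E} {r : R}
    (hr : G.base r = G.src e) (hne : G.src e ≠ G.tgt e) : N.pos (G.tgt e) ≠ 0 := by
  intro h0
  have h1 : crossProd (N.pos (G.tgt e)) (N.tangent (Sum.inl e) (N.length e)) = 0 := by
    simp [h0, crossProd]
  rw [← h.crossProd_src_eq_zero_iff] at h1
  have h2 := h.crossProd_ray r
  refine hne (N.pos_injective ?_)
  rw [h0]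
  refine (h.1.pos_eq_zero (d := Sum.inl (Sum.inl e)) (d' := Sum.inl (Sum.inr r)) (by simp)
    hr.symm h1 ?_)
  rw [hr] at h2
  exact h2

/-- A network with threefold symmetry whose number of junctions is not divisible by three has a
junction at the origin. -/
theorem IsRegular.exists_pos_eq_zero [Fintype V] [Finite E] [Finite R] (h : N.IsRegular)
    (hsym : N.HasThreefoldSymmetry) (hcard : ¬ 3 ∣ Fintype.card V) : ∃ v, N.pos v = 0 := by
  classical
  set ω := Complex.exp (2 * Real.pi / 3 * Complex.I) with hω
  have hprim : IsPrimitiveRoot ω 3 := by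
    have := Complex.isPrimitiveRoot_exp 3 (by norm_num)
    convert this using 2
    push_cast
    ring
  have hnorm : ‖ω‖ = 1 := hprim.norm'_eq_one (by norm_num)
  choose f hf using h.exists_pos_eq hnorm hsym
  by_contra hno
  push Not at hno
  -- The induced map on vertices has cube 1, so its number of fixed points is congruent to the
  -- number of vertices modulo 3. A fixed vertex would satisfy (ω - 1) p = 0, hence lie at the
  -- origin.
  have hcube : (show Function.End V from f) ^ 3 ^ 1 = 1 := by
    funext v
    apply N.pos_injective
    change N.pos (f (f (f v))) = N.pos v
    rw [hf, hf, hf, ← mul_assoc, ← mul_assoc, ← pow_three', hprim.pow_eq_one, one_mul]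
  have hfact : Fact (Nat.Prime 3) := ⟨Nat.prime_three⟩
  have hmod := Equiv.Perm.card_fixedPoints_modEq hcube
  have hempty : IsEmpty (Function.fixedPoints f) := by
    refine ⟨fun ⟨v, hv⟩ => hno v ?_⟩
    have h1 := hf v
    rw [show f v = v from hv] at h1
    have h2 : (ω - 1) * N.pos v = 0 := by linear_combination -h1
    exact (mul_eq_zero.1 h2).resolve_left (sub_ne_zero.2 (hprim.ne_one (by norm_num)))
  have hz : Fintype.card (Function.fixedPoints (show Function.End V from f)) = 0 :=
    Fintype.card_eq_zero_iff.2 hempty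
  rw [hz] at hmod
  exact hcard ((Nat.modEq_zero_iff_dvd).1 hmod)

/-- An edge that issues from the origin is a straight segment. -/
theorem IsRegularShrinker.eq_smul_of_src (h : N.IsRegularShrinker) {e : E}
    (h0 : N.pos (G.src e) = 0) {s : ℝ} (hs : s ∈ N.dom (Sum.inl e)) :
    N.tangent (Sum.inl e) s = N.tangent (Sum.inl e) 0 ∧
      N.curve (Sum.inl e) s = s • N.tangent (Sum.inl e) 0 := by
  have h1 := (h.isShrinkerArc (Sum.inl e)).eq_add_smul (N.convex_dom _) hs
    (N.zero_mem_dom (Sum.inl e)) (by rw [N.edge_src, h0]; simp [crossProd])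
  rwa [N.edge_src, h0, zero_add, sub_zero] at h1

/-- If the origin is a junction, the rays point outwards. -/
theorem IsRegularShrinker.exists_pos_base_eq_smul (h : N.IsRegularShrinker) {v : V}
    (h0 : N.pos v = 0) {r : R} (hr : G.base r ≠ v) :
    ∃ ρ : ℝ, 0 < ρ ∧ N.pos (G.base r) = ρ • N.tangent (Sum.inr r) 0 := by
  have harc := h.isShrinkerArc (Sum.inr r)
  have hz := N.zero_mem_dom (Sum.inr r)
  have hc := h.crossProd_ray r
  have hT := harc.normSq_tangent hz
  set p := N.pos (G.base r) with hp
  set T := N.tangent (Sum.inr r) 0 with hTdef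
  have hpT : p = (inner ℝ p T : ℝ) • T := by
    rw [crossProd] at hc
    apply Complex.ext <;> simp [-Complex.inner, inner_eq_re_add_im]
    · linear_combination (-p.re) * hT + T.im * hc
    · linear_combination (-p.im) * hT - T.re * hc
  refine ⟨inner ℝ p T, ?_, hpT⟩
  by_contra hle
  have hle' : 0 ≤ -(inner ℝ p T : ℝ) := by linarith
  rcases hle'.eq_or_lt with h1 | h1
  · apply hr
    apply N.pos_injective
    rw [h0, ← hp, hpT, show (inner ℝ p T : ℝ) = 0 by linarith, zero_smul]
  -- An inward ray is the straight line p + sT, which would run through the junction at the origin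
  -- at s = -⟨p, T⟩.
  · have hs := (harc.eq_add_smul (N.convex_dom _) (s := -(inner ℝ p T : ℝ)) h1.le hz
      (by rw [N.ray_base]; exact hc)).2
    rw [N.ray_base, ← hp, sub_zero, ← hTdef] at hs
    refine h.1.curve_ne_pos (c := Sum.inr r) (s := -(inner ℝ p T : ℝ)) ?_ v ?_
    · rw [dom, curveDomain_inr, interior_Ici]
      exact h1
    · rw [hs, h0]
      nth_rw 1 [hpT]
      rw [← add_smul, add_neg_cancel, zero_smul]

/-- The angles at a junction with a radial end `d`, which points outwards if `η = 1` and inwards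
if `η = -1`, an arriving edge `e` and a departing edge `e'`. -/
theorem IsRegular.angles_of_radial_end (h : N.IsRegular) {e e' : E} {d : G.End} {ρ η : ℝ}
    (hη : η = 1 ∨ η = -1) (hρ : 0 < ρ) (hd : d ≠ Sum.inr e) (hd' : d ≠ Sum.inl (Sum.inl e'))
    (hv : G.endVertex d = G.tgt e) (hv' : G.endVertex d = G.src e')
    (hpos : N.pos (G.endVertex d) = (η * ρ) • N.endTangent d) :
    0 < ‖N.pos (G.tgt e)‖ ∧
    inner ℝ (N.pos (G.tgt e)) (N.tangent (Sum.inl e) (N.length e)) / ‖N.pos (G.tgt e)‖ = η / 2 ∧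
    inner ℝ (N.pos (G.src e')) (N.tangent (Sum.inl e') 0) / ‖N.pos (G.src e')‖ = -(η / 2) ∧
    crossProd (N.pos (G.tgt e)) (N.tangent (Sum.inl e) (N.length e)) =
      crossProd (N.pos (G.src e')) (N.tangent (Sum.inl e') 0) ∧
    crossProd (N.pos (G.src e')) (N.tangent (Sum.inl e') 0) ≠ 0 := by
  have i1 := h.inner_endTangent hd hv
  have i2 := h.inner_endTangent hd' hv'
  have i3 := h.inner_endTangent (d := Sum.inr e) (d' := Sum.inl (Sum.inl e')) (by simp)
    (hv.symm.trans hv')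
  rw [← hv, ← hv', hpos]
  have hn := N.norm_endTangent d
  set n := N.endTangent d
  set T := N.tangent (Sum.inl e) (N.length e) with hT
  set T' := N.tangent (Sum.inl e') 0 with hT'
  rw [show N.endTangent (Sum.inr e) = -T from rfl] at i1 i3
  rw [show N.endTangent (Sum.inl (Sum.inl e')) = T' from rfl] at i2 i3
  rw [inner_neg_right] at i1
  rw [inner_neg_left] at i3
  have hnT' : ‖T'‖ = 1 := N.norm_tangent _ (N.zero_mem_dom _)
  have hnT : ‖T‖ = 1 := N.norm_tangent _ (N.length_mem_dom _)
  have hη2 : η ^ 2 = 1 := by rcases hη with rfl | rfl <;> norm_num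
  have hη1 : |η| = 1 := by rcases hη with rfl | rfl <;> norm_num
  have e1 := inner_mul_norm_sq T T' n
  have e2 := inner_sq_add_crossProd_sq n T
  have e3 := inner_sq_add_crossProd_sq n T'
  rw [hn, hnT, show (inner ℝ n T : ℝ) = 1 / 2 by linarith] at e2
  rw [hn, hnT', i2] at e3
  rw [hn, i2, show (inner ℝ n T : ℝ) = 1 / 2 by linarith,
    show (inner ℝ T T' : ℝ) = 1 / 2 by linarith] at e1
  -- Both squares and the product of these cross products equal 3/4. So the path keeps its sense of
  -- rotation about the origin as it passes the junction.
  have hcc : crossProd n T = crossProd n T' := by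
    have : (crossProd n T - crossProd n T') ^ 2 = 0 := by linarith
    exact sub_eq_zero.1 (pow_eq_zero_iff two_ne_zero |>.1 this)
  have hsm : ∀ z : ℂ, crossProd ((η * ρ) • n) z = η * ρ * crossProd n z := by
    intro z; simp [crossProd]; ring
  have hnorm : ‖(η * ρ) • n‖ = ρ := by
    rw [norm_smul, hn, mul_one, Real.norm_eq_abs, abs_mul, hη1, one_mul, abs_of_pos hρ]
  rw [hnorm, hsm, hsm, hcc, real_inner_smul_left, real_inner_smul_left, i2,
    show (inner ℝ n T : ℝ) = 1 / 2 by linarith]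
  refine ⟨hρ, by field_simp, by field_simp, rfl, ?_⟩
  have hη0 : η ≠ 0 := by rcases hη with rfl | rfl <;> norm_num
  refine mul_ne_zero (mul_ne_zero hη0 hρ.ne') fun h0 => ?_
  rw [h0] at e3
  norm_num at e3

end Network

theorem radialCos_inner_crossProd {γ T : ℝ → ℂ} {D : Set ℝ} (h : IsShrinkerArc γ T D) {σ s : ℝ}
    (hσ : σ ^ 2 = 1) (hs : s ∈ D) :
    radialCos (fun s => inner ℝ (γ s) (T s)) (fun s => σ * crossProd (γ s) (T s)) s =
      inner ℝ (γ s) (T s) / ‖γ s‖ := by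
  rw [radialCos, mul_pow, hσ, one_mul, h.sq_norm_curve hs, Real.sqrt_sq (norm_nonneg _)]

namespace Network

variable {V E R : Type} {G : RayGraph V E R} {N : Network G}

/-- A chain of three edges that forms Herring angles with the radial direction runs around the
origin monotonically, by an angle of more than `2π/3`. -/
theorem IsRegularShrinker.exists_hasPolarGraph (h : N.IsRegularShrinker) {e₁ e₂ e₃ : E} {σ : ℝ}
    (hσ : σ = 1 ∨ σ = -1) (h₁₂ : G.tgt e₁ = G.src e₂) (h₂₃ : G.tgt e₂ = G.src e₃)
    (hX₁ : 0 < σ * crossProd (N.pos (G.src e₁)) (N.tangent (Sum.inl e₁) 0))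
    (hX₂ : crossProd (N.pos (G.tgt e₁)) (N.tangent (Sum.inl e₁) (N.length e₁)) =
      crossProd (N.pos (G.src e₂)) (N.tangent (Sum.inl e₂) 0))
    (hX₃ : crossProd (N.pos (G.tgt e₂)) (N.tangent (Sum.inl e₂) (N.length e₂)) =
      crossProd (N.pos (G.src e₃)) (N.tangent (Sum.inl e₃) 0))
    (c₁ : inner ℝ (N.pos (G.src e₁)) (N.tangent (Sum.inl e₁) 0) / ‖N.pos (G.src e₁)‖ = 1 / 2)
    (c₁' : inner ℝ (N.pos (G.tgt e₁)) (N.tangent (Sum.inl e₁) (N.length e₁)) /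
      ‖N.pos (G.tgt e₁)‖ = 1 / 2)
    (c₂ : inner ℝ (N.pos (G.src e₂)) (N.tangent (Sum.inl e₂) 0) / ‖N.pos (G.src e₂)‖ = -(1 / 2))
    (c₂' : inner ℝ (N.pos (G.tgt e₂)) (N.tangent (Sum.inl e₂) (N.length e₂)) /
      ‖N.pos (G.tgt e₂)‖ = 1 / 2)
    (c₃ : inner ℝ (N.pos (G.src e₃)) (N.tangent (Sum.inl e₃) 0) / ‖N.pos (G.src e₃)‖ = -(1 / 2))
    (c₃' : inner ℝ (N.pos (G.tgt e₃)) (N.tangent (Sum.inl e₃) (N.length e₃)) /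
      ‖N.pos (G.tgt e₃)‖ = -(1 / 2)) :
    0 < σ * crossProd (N.pos (G.tgt e₃)) (N.tangent (Sum.inl e₃) (N.length e₃)) ∧
    ∃ Δ, 2 * Real.pi / 3 < Δ ∧ ∀ a : ℝ,
      N.pos (G.src e₁) = ‖N.pos (G.src e₁)‖ * Complex.exp (σ * a * Complex.I) →
      HasPolarGraph σ a (a + Δ) (N.pos (G.src e₁)) (N.pos (G.tgt e₃))
        (N.curve (Sum.inl e₁) '' Ioo 0 (N.length e₁) ∪ {N.pos (G.tgt e₁)} ∪
          N.curve (Sum.inl e₂) '' Ioo 0 (N.length e₂) ∪ {N.pos (G.tgt e₂)} ∪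
          N.curve (Sum.inl e₃) '' Ioo 0 (N.length e₃)) := by
  have hσ2 : σ ^ 2 = 1 := by rcases hσ with rfl | rfl <;> norm_num
  have arc : ∀ e, IsShrinkerArc (N.curve (Sum.inl e)) (N.tangent (Sum.inl e))
      (Icc 0 (N.length e)) := fun e => h.isShrinkerArc (Sum.inl e)
  have z : ∀ e, (0 : ℝ) ∈ Icc 0 (N.length e) := fun e => N.zero_mem_dom (Sum.inl e)
  have l : ∀ e, N.length e ∈ Icc 0 (N.length e) := fun e => N.length_mem_dom e
  have hpos : ∀ e, 0 < σ * crossProd (N.curve (Sum.inl e) 0) (N.tangent (Sum.inl e) 0) →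
      ∀ s ∈ Icc 0 (N.length e),
        0 < σ * crossProd (N.curve (Sum.inl e) s) (N.tangent (Sum.inl e) s) :=
    fun e he s hs => (arc e).mul_crossProd_pos (convex_Icc _ _) hs (z e) he
  have hne : ∀ e, 0 < σ * crossProd (N.curve (Sum.inl e) 0) (N.tangent (Sum.inl e) 0) →
      ∀ s ∈ Icc 0 (N.length e), N.curve (Sum.inl e) s ≠ 0 := by
    intro e he s hs h0
    have := hpos e he s hs
    simp [h0, crossProd] at this
  have hy : ∀ e s, s ∈ Icc 0 (N.length e) →
      (inner ℝ (N.curve (Sum.inl e) s) (N.tangent (Sum.inl e) s) : ℝ) ^ 2 +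
        (σ * crossProd (N.curve (Sum.inl e) s) (N.tangent (Sum.inl e) s)) ^ 2 =
        ‖N.curve (Sum.inl e) s‖ ^ 2 := by
    intro e s hs
    rw [mul_pow, hσ2, one_mul, (arc e).sq_norm_curve hs]
  have hc : ∀ e s, s ∈ Icc 0 (N.length e) → radialCos
      (fun s => inner ℝ (N.curve (Sum.inl e) s) (N.tangent (Sum.inl e) s))
      (fun s => σ * crossProd (N.curve (Sum.inl e) s) (N.tangent (Sum.inl e) s)) s =
      inner ℝ (N.curve (Sum.inl e) s) (N.tangent (Sum.inl e) s) / ‖N.curve (Sum.inl e) s‖ :=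
    fun e s hs => radialCos_inner_crossProd (arc e) hσ2 hs
  simp only [← N.edge_src, ← N.edge_tgt] at hX₁ hX₂ hX₃ c₁ c₁' c₂ c₂' c₃ c₃'
  have p₁₂ : N.curve (Sum.inl e₁) (N.length e₁) = N.curve (Sum.inl e₂) 0 := by
    rw [N.edge_src, N.edge_tgt, h₁₂]
  have p₂₃ : N.curve (Sum.inl e₂) (N.length e₂) = N.curve (Sum.inl e₃) 0 := by
    rw [N.edge_src, N.edge_tgt, h₂₃]
  have hY₂ : 0 < σ * crossProd (N.curve (Sum.inl e₂) 0) (N.tangent (Sum.inl e₂) 0) := by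
    rw [← hX₂]; exact hpos e₁ hX₁ _ (l e₁)
  have hY₃ : 0 < σ * crossProd (N.curve (Sum.inl e₃) 0) (N.tangent (Sum.inl e₃) 0) := by
    rw [← hX₃]; exact hpos e₂ hY₂ _ (l e₂)
  obtain ⟨θ₁, hθ₁, h₁, hp₁⟩ := (arc e₁).exists_angle (N.length_pos e₁) hσ2 hX₁
  obtain ⟨θ₂, hθ₂, h₂, hp₂⟩ := (arc e₂).exists_angle (N.length_pos e₂) hσ2 hY₂
  obtain ⟨θ₃, hθ₃, h₃, hp₃⟩ := (arc e₃).exists_angle (N.length_pos e₃) hσ2 hY₃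
  have hΔ := two_pi_div_three_lt_angle h₁ h₂ h₃
    (by rw [hc _ _ (z e₁), c₁]) (by rw [hc _ _ (l e₁), c₁'])
    (by rw [hc _ _ (z e₂), c₂]) (by rw [hc _ _ (l e₂), c₂'])
    (by rw [hc _ _ (z e₃), c₃]) (by rw [hc _ _ (l e₃), c₃'])
    (by rw [hy _ _ (l e₁), hy _ _ (z e₂), p₁₂]) (by rw [hy _ _ (l e₂), hy _ _ (z e₃), p₂₃])
  have i₁ : 0 < θ₁ (N.length e₁) := by
    have := h₁.strictMonoOn_θ (z e₁) (l e₁) (N.length_pos e₁); rwa [hθ₁] at this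
  have i₂ : 0 < θ₂ (N.length e₂) := by
    have := h₂.strictMonoOn_θ (z e₂) (l e₂) (N.length_pos e₂); rwa [hθ₂] at this
  have i₃ : 0 < θ₃ (N.length e₃) := by
    have := h₃.strictMonoOn_θ (z e₃) (l e₃) (N.length_pos e₃); rwa [hθ₃] at this
  rw [hθ₁, hθ₂, hθ₃, sub_zero, sub_zero, sub_zero] at hΔ
  simp only [← N.edge_src, ← N.edge_tgt]
  refine ⟨hpos e₃ hY₃ _ (l e₃), _, hΔ, fun a ha => ?_⟩
  have cc : ∀ e, ContinuousOn (N.curve (Sum.inl e)) (Icc 0 (N.length e)) :=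
    fun e => N.continuousOn_curve (Sum.inl e)
  -- Each edge starts at the polar angle at which the preceding one stops.
  have q₁ := hp₁ a ha
  have g₁ := h₁.hasPolarGraph (cc e₁) (hne e₁ hX₁) hθ₁ q₁
  have q₂ := hp₂ (a + θ₁ (N.length e₁)) (by rw [← p₁₂]; exact q₁ _ (l e₁))
  have g₂ := h₂.hasPolarGraph (cc e₂) (hne e₂ hY₂) hθ₂ q₂
  have q₃ := hp₃ (a + θ₁ (N.length e₁) + θ₂ (N.length e₂))
    (by rw [← p₂₃]; exact q₂ _ (l e₂))
  have g₃ := h₃.hasPolarGraph (cc e₃) (hne e₃ hY₃) hθ₃ q₃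
  rw [← p₁₂] at g₂
  rw [← p₂₃] at g₃
  have := (g₁.trans (by linarith) (by linarith) g₂).trans (by linarith) (by linarith) g₃
  rwa [show a + θ₁ (N.length e₁) + θ₂ (N.length e₂) + θ₃ (N.length e₃) =
    a + (θ₁ (N.length e₁) + θ₂ (N.length e₂) + θ₃ (N.length e₃)) by ring] at this

end Network

/-! ### The star and the contradiction -/

/-- The junctions of the star as a disjoint union. -/
def starVertexEquiv : Unit ⊕ (ZMod 3 ⊕ (ZMod 3 ⊕ ZMod 3)) ≃ StarVertex where
  toFun := Sum.elim (fun _ => .center) (Sum.elim .spokeEnd (Sum.elim .firstTwin .secondTwin))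
  invFun
    | .center => Sum.inl ()
    | .spokeEnd i => Sum.inr (Sum.inl i)
    | .firstTwin i => Sum.inr (Sum.inr (Sum.inl i))
    | .secondTwin i => Sum.inr (Sum.inr (Sum.inr i))
  left_inv x := by rcases x with _ | _ | _ | _ <;> rfl
  right_inv x := by cases x <;> rfl

instance : Fintype StarVertex := Fintype.ofEquiv _ starVertexEquiv

theorem card_starVertex : Fintype.card StarVertex = 10 := by
  rw [← Fintype.card_congr starVertexEquiv]
  simp

instance : Finite StarEdge := by
  refine Finite.of_surjective (Sum.elim StarEdge.spoke (Sum.elim StarEdge.outer₁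
    (Sum.elim StarEdge.outer₂ StarEdge.outer₃)) : ZMod 3 ⊕ (ZMod 3 ⊕ (ZMod 3 ⊕ ZMod 3)) → _) ?_
  rintro (i | i | i | i)
  exacts [⟨.inl i, rfl⟩, ⟨.inr (.inl i), rfl⟩, ⟨.inr (.inr (.inl i)), rfl⟩,
    ⟨.inr (.inr (.inr i)), rfl⟩]

instance : Finite StarRay := by
  refine Finite.of_surjective (Sum.elim StarRay.first StarRay.second : ZMod 3 ⊕ ZMod 3 → _) ?_
  rintro (i | i)
  exacts [⟨.inl i, rfl⟩, ⟨.inr i, rfl⟩]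

/-- The index of the outer path that contains a vertex or a curve of the star. -/
def outerPath : StarVertex ⊕ (StarEdge ⊕ StarRay) → Option (ZMod 3)
  | .inl (.firstTwin i) => some i
  | .inl (.secondTwin i) => some i
  | .inr (.inl (.outer₁ i)) => some i
  | .inr (.inl (.outer₂ i)) => some i
  | .inr (.inl (.outer₃ i)) => some i
  | _ => none

/-- Every junction other than the centre is joined by an edge to a twin, which carries a ray, so it
cannot be the junction at the origin. -/
theorem pos_center_eq_zero {N : Network cisgeminateThreeRayStar} (h : N.IsRegularShrinker)
    (hsym : N.HasThreefoldSymmetry) : N.pos .center = 0 := by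
  obtain ⟨v, hv⟩ := h.1.exists_pos_eq_zero hsym (by rw [card_starVertex]; norm_num)
  cases v with
  | center => exact hv
  | spokeEnd i =>
    exact absurd hv (h.pos_src_ne_zero (e := .outer₁ i) (r := .first i) rfl (by
      simp [cisgeminateThreeRayStar]))
  | firstTwin i =>
    exact absurd hv (h.pos_src_ne_zero (e := .outer₂ i) (r := .second i) rfl (by
      simp [cisgeminateThreeRayStar]))
  | secondTwin i =>
    exact absurd hv (h.pos_tgt_ne_zero (e := .outer₂ i) (r := .first i) rfl (by
      simp [cisgeminateThreeRayStar]))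

theorem mainTheorem11 :
    ¬ ∃ N : Network cisgeminateThreeRayStar,
      N.IsRegularShrinker ∧ N.HasThreefoldSymmetry := by
  rintro ⟨N, h, hsym⟩
  have h0 := pos_center_eq_zero h hsym
  set u : ZMod 3 → ℂ := fun i => N.tangent (Sum.inl (.spoke i)) 0 with hu
  set ℓ : ZMod 3 → ℝ := fun i => N.length (.spoke i) with hℓ
  have hℓ0 : ∀ i, 0 < ℓ i := fun i => N.length_pos _
  have hcurve : ∀ i, ∀ r ∈ Icc 0 (ℓ i), N.curve (Sum.inl (.spoke i)) r = r * u i := by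
    intro i r hr
    rw [← Complex.real_smul]
    exact (h.eq_smul_of_src (e := .spoke i) h0 hr).2
  have hend : ∀ i, N.pos (.spokeEnd i) = ℓ i * u i := fun i =>
    (N.edge_tgt (.spoke i)).symm.trans (hcurve i _ (N.length_mem_dom _))
  have hu1 : ∀ i, ‖u i‖ = 1 := fun i => N.norm_tangent _ (N.zero_mem_dom _)
  -- At the twins the radial end is a ray pointing outwards (η = 1). At the end of a spoke it is the
  -- spoke itself, seen pointing back to the origin (η = -1).
  have hA : ∀ i, _ := fun i =>
    have ⟨ρ, hρ, e⟩ := h.exists_pos_base_eq_smul h0 (r := .first i) (by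
      simp [cisgeminateThreeRayStar])
    h.1.angles_of_radial_end (e := .outer₁ i) (e' := .outer₂ i)
      (d := .inl (.inr (.first i))) (η := 1) (Or.inl rfl) hρ (by simp) (by simp) rfl rfl
      (by rw [one_mul]; exact e)
  have hB : ∀ i, _ := fun i =>
    have ⟨ρ, hρ, e⟩ := h.exists_pos_base_eq_smul h0 (r := .second i) (by
      simp [cisgeminateThreeRayStar])
    h.1.angles_of_radial_end (e := .outer₂ i) (e' := .outer₃ i)
      (d := .inl (.inr (.second i))) (η := 1) (Or.inl rfl) hρ (by simp) (by simp) rfl rfl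
      (by rw [one_mul]; exact e)
  have hC : ∀ i, _ := fun i =>
    h.1.angles_of_radial_end (e := .outer₃ i) (e' := .outer₁ (i + 1))
      (d := .inr (.spoke (i + 1))) (η := -1) (Or.inr rfl) (hℓ0 (i + 1)) (by simp) (by simp) rfl rfl
      (by
        rw [show N.endTangent (.inr (.spoke (i + 1))) = -u (i + 1) from
          congrArg Neg.neg (h.eq_smul_of_src (e := .spoke (i + 1)) h0 (N.length_mem_dom _)).1,
          neg_one_mul, neg_smul_neg, Complex.real_smul]
        exact hend (i + 1))
  have hzmod : ∀ i : ZMod 3, i - 1 + 1 = i := by decide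
  have hX : ∀ i, crossProd (N.pos (.spokeEnd i)) (N.tangent (Sum.inl (.outer₁ i)) 0) ≠ 0 := by
    intro i
    have := (hC (i - 1)).2.2.2.2
    rw [hzmod] at this
    exact this
  -- The sense of rotation is read off at spoke 0; since it survives every junction, it is passed on
  -- around `ZMod 3` to all three paths.
  obtain ⟨σ, hσ, hσ0⟩ : ∃ σ : ℝ, (σ = 1 ∨ σ = -1) ∧
      0 < σ * crossProd (N.pos (.spokeEnd 0)) (N.tangent (Sum.inl (.outer₁ 0)) 0) := by
    rcases (hX 0).lt_or_gt with hlt | hgt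
    · exact ⟨-1, Or.inr rfl, by linarith⟩
    · exact ⟨1, Or.inl rfl, by linarith⟩
  have hpath := fun (i : ZMod 3) (hi : 0 < σ *
      crossProd (N.pos (.spokeEnd i)) (N.tangent (Sum.inl (.outer₁ i)) 0)) =>
    h.exists_hasPolarGraph (e₁ := .outer₁ i) (e₂ := .outer₂ i) (e₃ := .outer₃ i) hσ rfl rfl hi
      (hA i).2.2.2.1 (hB i).2.2.2.1
      (by
        have := (hC (i - 1)).2.2.1
        rw [hzmod] at this
        rw [this]; norm_num)
      (hA i).2.1 (hA i).2.2.1 (hB i).2.1 (hB i).2.2.1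
      (by rw [(hC i).2.1]; norm_num)
  have hstep : ∀ i : ZMod 3,
      0 < σ * crossProd (N.pos (.spokeEnd i)) (N.tangent (Sum.inl (.outer₁ i)) 0) →
      0 < σ * crossProd (N.pos (.spokeEnd (i + 1)))
        (N.tangent (Sum.inl (.outer₁ (i + 1))) 0) := by
    intro i hi
    have := (hpath i hi).1
    rw [(hC i).2.2.2.1] at this
    exact this
  have hall : ∀ i : ZMod 3,
      0 < σ * crossProd (N.pos (.spokeEnd i)) (N.tangent (Sum.inl (.outer₁ i)) 0) := by
    have hz : ∀ i : ZMod 3, i = 0 ∨ i = 0 + 1 ∨ i = 0 + 1 + 1 := by decide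
    intro i
    rcases hz i with rfl | rfl | rfl
    exacts [hσ0, hstep _ hσ0, hstep _ (hstep _ hσ0)]
  choose Δ hΔ hgraph using fun i => (hpath i (hall i)).2
  have hint : ∀ e, interior (N.dom (Sum.inl e)) = Ioo 0 (N.length e) := fun e => by
    rw [Network.dom, curveDomain_inl, interior_Icc]
  set K : ZMod 3 → Set ℂ := fun i =>
    N.curve (Sum.inl (.outer₁ i)) '' Ioo 0 (N.length (.outer₁ i)) ∪ {N.pos (.firstTwin i)} ∪
      N.curve (Sum.inl (.outer₂ i)) '' Ioo 0 (N.length (.outer₂ i)) ∪ {N.pos (.secondTwin i)} ∪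
      N.curve (Sum.inl (.outer₃ i)) '' Ioo 0 (N.length (.outer₃ i)) with hK
  have hKpiece : ∀ i, ∀ p ∈ K i, ∃ x, p ∈ N.piece x ∧ outerPath x = some i := by
    rintro i p ((((hp | hp) | hp) | hp) | hp)
    · exact ⟨.inr (.inl (.outer₁ i)), by rw [← hint] at hp; exact hp, rfl⟩
    · exact ⟨.inl (.firstTwin i), hp, rfl⟩
    · exact ⟨.inr (.inl (.outer₂ i)), by rw [← hint] at hp; exact hp, rfl⟩
    · exact ⟨.inl (.secondTwin i), hp, rfl⟩
    · exact ⟨.inr (.inl (.outer₃ i)), by rw [← hint] at hp; exact hp, rfl⟩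
  -- The remaining disjointness claims hold because distinct pieces are disjoint and `outerPath`
  -- separates the pieces: spokes have index `none`, the i-th path `some i`.
  refine false_of_hasPolarGraph hσ ℓ u K Δ hℓ0 hu1 ?_ hΔ ?_ ?_ ?_
  · intro i j hij
    exact h.1.inner_endTangent (d := .inl (.inl (.spoke i))) (d' := .inl (.inl (.spoke j)))
      (by simpa using hij) rfl
  · intro i a ha
    rw [← hend, ← hend]
    refine hgraph i a ?_
    change N.pos (.spokeEnd i) = ‖N.pos (.spokeEnd i)‖ * _
    rw [hend, norm_mul, hu1, mul_one, Complex.norm_real, Real.norm_of_nonneg (hℓ0 i).le, ← ha]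
  · intro i j r hr hmem
    obtain ⟨x, hx, hxi⟩ := hKpiece i _ hmem
    have hy : ∃ y, (r : ℂ) * u j ∈ N.piece y ∧ outerPath y = none := by
      rw [← hcurve j r hr]
      rcases eq_endpoints_or_mem_Ioo_of_mem_Icc hr with rfl | rfl | hr'
      · exact ⟨.inl .center, N.edge_src (.spoke j), rfl⟩
      · exact ⟨.inl (.spokeEnd j), N.edge_tgt (.spoke j), rfl⟩
      · exact ⟨.inr (.inl (.spoke j)), mem_image_of_mem _ (by rw [hint]; exact hr'), rfl⟩
    obtain ⟨y, hy, hyi⟩ := hy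
    rw [h.1.eq_of_mem_piece hx hy, hyi] at hxi
    exact absurd hxi (by simp)
  · intro i j hij
    refine disjoint_left.2 fun p hi hj => hij ?_
    obtain ⟨x, hx, hxi⟩ := hKpiece i p hi
    obtain ⟨y, hy, hyj⟩ := hKpiece j p hj
    rw [h.1.eq_of_mem_piece hx hy, hyj] at hxi
    exact (Option.some.inj hxi).symm
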